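/- Let $K$ be a field of characteristic $0$, complete with respect to a non-trivial non-archimedean absolute value $|\cdot|$ and algebraically closed, with residue field $k$ of characteristic $p>0$. Write $D(a,r)$, $\bar D(a,r)$ for the open and closed disks in $K$, and let $\mathcal P^1(K)$ be the Berkovich projective line, that is, the one-point compactification of the space $\mathcal A^1(K)$ of multiplicative seminorms on $K[z]$ extending $|\cdot|$. For $a\in K$, $\rho>0$ let $\nu(a,\rho)\in\mathcal A^1(K)$ be the norm $\sum d_i(z-a)^i\mapsto\max_i|d_i|\rho^i$. For $f\in K(z)$ and $\nu\in\mathcal A^1(K)$ let $f_*(\nu)\in\mathcal P^1(K)$ be the image point: $\|h\|_{f_*(\nu)}=\|h\circ f\|_\nu$ for $h\in K[z]$, with $f_*(\nu)=\infty$ if $\nu$ is a pole of $f$. Let $$L(f,\nu)=r(\nu)\,f^{\#}(\nu),\qquad f^{\#}(\nu)=\frac{\|f'\|_\nu}{\max\{1,\|f\|_\nu^2\}},\qquad r(\nu)=\frac{\inf_{b\in K}\|z-b\|_\nu}{\max\{1,\|z\|_\nu^2\}},$$ (so $r(\nu(a,\rho))=\rho/\max\{1,\rho^2,|a|^2\}$),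 where at a pole of $f$ one takes $f^{\#}=(1/f)^{\#}$. Put $\nu_1=\nu(0,1)$. Let $N\ge 0$ be an integer and $0<s\le 1$. Then there are $a_0,\dots,a_N\in K$ with $$a_0=0,\qquad |a_i|=1\ (1\le i\le N),\qquad |a_i-a_j|=1\ (i\ne j),$$ there is an integer $n\ge1$ with $|p^n|<s$, and there is $b\in K$ with $0<|b|<s$. Moreover, for every such choice of $a_0,\dots,a_N$, consider the $N+2$ islands $D(a_0,s),\dots,D(a_N,s)$ and $\mathbb P^1(K)\setminus\bar D(0,1/s)$. Then: 1. points of two different islands always lie in different connected components of $\mathcal P^1(K)\setminus\{\nu_1\}$; 2. for every $n\ge1$ with $|p^n|<s$ and every $b\in K$ with $0<|b|<s$, setting $c=-b^{1+p^n}$, the rational function $$f(z)=\Bigl(z+\frac{c}{z^{p^n}}\Bigr)\prod_{i=1}^N\Bigl(1+\frac{c}{(z-a_i)^{p^n}}\Bigr)$$ satisfies $f_*(\nu_1)=\nu_1$ and $L(f,\nu_1)=1$, and yet there is no open or closed disk $U\subseteq K$ on which $f$ is one-to-one and whose image $f(U)$ is one of the $N+2$ islands; 3. consequently a lower bound on $L$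 at only one preimage of $\nu_1$ cannot suffice: for every real $C\le 1$ it is false that every $f\in K(z)$ for which there is some $\nu\in\mathcal A^1(K)$ with $f_*(\nu)=\nu_1$ and $L(f,\nu)\ge C$ maps some disk $U\subseteq K$ one-to-one onto one of the $N+2$ islands. -/

import Mathlib

open scoped Polynomial

/-- A point of the Berkovich affine line over `K`: a multiplicative seminorm on `K[X]`
that extends the absolute value of `K` and satisfies the ultrametric inequality. -/
structure BerkovichLine (K : Type*) [NormedField K] where
  toFun : K[X] → ℝ
  map_C' : ∀ c : K, toFun (Polynomial.C c) = ‖c‖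
  map_mul' : ∀ g h : K[X], toFun (g * h) = toFun g * toFun h
  map_add_le' : ∀ g h : K[X], toFun (g + h) ≤ max (toFun g) (toFun h)

namespace BerkovichLine

section NormedField

variable {K : Type*} [NormedField K]

instance : CoeFun (BerkovichLine K) (fun _ => K[X] → ℝ) := ⟨toFun⟩

/-- The weakest topology for which every `ν ↦ ‖g‖_ν` is continuous. -/
instance : TopologicalSpace (BerkovichLine K) :=
  TopologicalSpace.induced toFun inferInstance

theorem map_one (ν : BerkovichLine K) : ν 1 = 1 := by
  simpa using ν.map_C' 1

theorem map_zero (ν : BerkovichLine K) : ν 0 = 0 := by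
  simpa using ν.map_C' 0

theorem map_neg (ν : BerkovichLine K) (g : K[X]) : ν (-g) = ν g := by
  have h := ν.map_mul' (Polynomial.C (-1)) g
  rw [ν.map_C'] at h
  simpa using h

theorem nonneg (ν : BerkovichLine K) (g : K[X]) : 0 ≤ ν g := by
  have h := ν.map_add_le' g (-g)
  rw [ν.map_neg, add_neg_cancel, ν.map_zero, max_self] at h
  exact h

theorem map_ne_zero_of_dvd (ν : BerkovichLine K) {g h : K[X]} (hd : g ∣ h) (hh : ν h ≠ 0) :
    ν g ≠ 0 := by
  obtain ⟨q, rfl⟩ := hd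
  rw [ν.map_mul'] at hh
  exact left_ne_zero_of_mul hh

/-- `‖f‖_ν = ‖P‖_ν / ‖Q‖_ν` for a rational function `f = P / Q` in lowest terms.
It is used only where `f` has no pole at `ν`, that is, where `‖Q‖_ν ≠ 0`. -/
noncomputable def ratNorm (ν : BerkovichLine K) (f : RatFunc K) : ℝ :=
  ν f.num / ν f.denom

theorem ratNorm_mul (ν : BerkovichLine K) {f g : RatFunc K} (hf : ν f.denom ≠ 0)
    (hg : ν g.denom ≠ 0) : ν.ratNorm (f * g) = ν.ratNorm f * ν.ratNorm g := by
  have hfg : ν (f * g).denom ≠ 0 :=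
    ν.map_ne_zero_of_dvd (RatFunc.denom_mul_dvd f g) (by rw [ν.map_mul']; exact mul_ne_zero hf hg)
  have h := congrArg ν.toFun (RatFunc.num_denom_mul f g)
  simp only [ν.map_mul'] at h
  unfold ratNorm
  field_simp
  linarith

theorem ratNorm_add_le (ν : BerkovichLine K) {f g : RatFunc K} (hf : ν f.denom ≠ 0)
    (hg : ν g.denom ≠ 0) : ν.ratNorm (f + g) ≤ max (ν.ratNorm f) (ν.ratNorm g) := by
  have hfg : ν (f + g).denom ≠ 0 :=
    ν.map_ne_zero_of_dvd (RatFunc.denom_add_dvd f g) (by rw [ν.map_mul']; exact mul_ne_zero hf hg)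
  have h := congrArg ν.toFun (RatFunc.num_denom_add f g)
  simp only [ν.map_mul'] at h
  have hle := ν.map_add_le' (f.num * g.denom) (f.denom * g.num)
  simp only [ν.map_mul'] at hle
  have pf := lt_of_le_of_ne (ν.nonneg _) hf.symm
  have pg := lt_of_le_of_ne (ν.nonneg _) hg.symm
  have e : ν.ratNorm (f + g)
      = ν.toFun (f.num * g.denom + f.denom * g.num) / (ν f.denom * ν g.denom) := by
    unfold ratNorm
    rw [div_eq_div_iff hfg (mul_ne_zero hf hg), h]
  rw [e, div_le_iff₀ (mul_pos pf pg), max_mul_of_nonneg _ _ (mul_pos pf pg).le]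
  refine hle.trans (le_of_eq ?_)
  unfold ratNorm
  congr 1 <;> field_simp

theorem denom_aeval_ne_zero (ν : BerkovichLine K) {f : RatFunc K} (hf : ν f.denom ≠ 0)
    (h : K[X]) : ν (Polynomial.aeval f h).denom ≠ 0 := by
  have hC : ∀ c : K, ν (algebraMap K (RatFunc K) c).denom ≠ 0 := fun c => by
    rw [RatFunc.algebraMap_eq_C, RatFunc.denom_C, ν.map_one]
    exact one_ne_zero
  have hmul : ∀ a b : RatFunc K, ν a.denom ≠ 0 → ν b.denom ≠ 0 → ν (a * b).denom ≠ 0 :=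
    fun a b ha hb => ν.map_ne_zero_of_dvd (RatFunc.denom_mul_dvd a b)
      (by rw [ν.map_mul']; exact mul_ne_zero ha hb)
  have hadd : ∀ a b : RatFunc K, ν a.denom ≠ 0 → ν b.denom ≠ 0 → ν (a + b).denom ≠ 0 :=
    fun a b ha hb => ν.map_ne_zero_of_dvd (RatFunc.denom_add_dvd a b)
      (by rw [ν.map_mul']; exact mul_ne_zero ha hb)
  induction h using Polynomial.induction_on with
  | C a => simpa using hC a
  | add p q hp hq => rw [_root_.map_add]; exact hadd _ _ hp hq
  | monomial n a ih =>
    rw [pow_succ, ← mul_assoc, _root_.map_mul, Polynomial.aeval_X]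
    exact hmul _ _ ih hf

open Classical in
/-- The map `f_*` from the Berkovich affine line to the Berkovich projective line induced by a
rational function `f`. If `ν` is a pole of `f` then `f_*(ν) = ∞`; otherwise `f_*(ν)` is the
seminorm `h ↦ ‖h ∘ f‖_ν`. -/
noncomputable def map (f : RatFunc K) (ν : BerkovichLine K) : OnePoint (BerkovichLine K) :=
  if hf : ν f.denom = 0 then OnePoint.infty else
    OnePoint.some
      { toFun := fun h => ν.ratNorm (Polynomial.aeval f h)
        map_C' := fun c => by
          rw [Polynomial.aeval_C, RatFunc.algebraMap_eq_C, ratNorm, RatFunc.num_C,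
            RatFunc.denom_C, ν.map_C', ν.map_one, div_one]
        map_mul' := fun g h => by
          rw [_root_.map_mul]
          exact ν.ratNorm_mul (ν.denom_aeval_ne_zero hf g) (ν.denom_aeval_ne_zero hf h)
        map_add_le' := fun g h => by
          rw [_root_.map_add]
          exact ν.ratNorm_add_le (ν.denom_aeval_ne_zero hf g) (ν.denom_aeval_ne_zero hf h) }

/-- The derivative of a rational function. -/
noncomputable def ratDeriv (f : RatFunc K) : RatFunc K :=
  algebraMap K[X] (RatFunc K)
      (Polynomial.derivative f.num * f.denom - f.num * Polynomial.derivative f.denom) /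
    algebraMap K[X] (RatFunc K) (f.denom ^ 2)

open Classical in
/-- The spherical derivative `f^#(ν) = ‖f'‖_ν / max {1, ‖f‖_ν ^ 2}`; at a pole of `f` it is
that of `1 / f`. -/
noncomputable def sphericalDeriv (f : RatFunc K) (ν : BerkovichLine K) : ℝ :=
  if ν f.denom = 0 then ν.ratNorm (ratDeriv f⁻¹) / max 1 (ν.ratNorm f⁻¹ ^ 2)
  else ν.ratNorm (ratDeriv f) / max 1 (ν.ratNorm f ^ 2)

/-- The spherical radius `r(ν)`. The infimum is the radius of `ν`, so that
`r(ν(a,ρ)) = ρ / max {1, ρ ^ 2, |a| ^ 2}`; see `sphericalRadius_diskPoint`. -/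
noncomputable def sphericalRadius (ν : BerkovichLine K) : ℝ :=
  (⨅ b : K, ν (Polynomial.X - Polynomial.C b)) / max 1 (ν Polynomial.X ^ 2)

/-- The relative boundary length `L(f, ν) = r(ν) * f^#(ν)`. -/
noncomputable def boundaryLength (f : RatFunc K) (ν : BerkovichLine K) : ℝ :=
  ν.sphericalRadius * sphericalDeriv f ν

end NormedField

section Ultrametric

variable {K : Type*} [NormedField K] [IsUltrametricDist K]

/-- The type I point given by `x`, the seminorm `g ↦ |g(x)|`. -/
def typeI (x : K) : BerkovichLine K where
  toFun g := ‖g.eval x‖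
  map_C' c := by simp
  map_mul' g h := by simp
  map_add_le' g h := by
    rw [Polynomial.eval_add]
    exact IsUltrametricDist.norm_add_le_max _ _

/-- The point `ν(a, ρ)` given by the disk of center `a` and radius `ρ`: if
`g = ∑ d_i (X - a) ^ i`, then `‖g‖ = max |d_i| ρ ^ i`. -/
noncomputable def diskPoint (a : K) (ρ : ℝ) (hρ : 0 < ρ) : BerkovichLine K where
  toFun g := (Polynomial.taylor a g).gaussNorm (NormedField.toAbsoluteValue K) ρ
  map_C' c := by
    rw [Polynomial.taylor_C, Polynomial.gaussNorm_C]
    rfl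
  map_mul' g h := by
    rw [Polynomial.taylor_mul]
    exact Polynomial.gaussNorm_mul (fun x y => IsUltrametricDist.norm_add_le_max x y) hρ _ _
  map_add_le' g h := by
    rw [_root_.map_add]
    exact Polynomial.isNonarchimedean_gaussNorm (NormedField.toAbsoluteValue K)
      (fun x y => IsUltrametricDist.norm_add_le_max x y) hρ.le _ _

theorem diskPoint_X_sub_C (a b : K) (ρ : ℝ) (hρ : 0 < ρ) :
    diskPoint a ρ hρ (Polynomial.X - Polynomial.C b) = max ‖a - b‖ ρ := by
  have e : Polynomial.taylor a (Polynomial.X - Polynomial.C b)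
      = Polynomial.X + Polynomial.C (a - b) := by
    simp only [_root_.map_sub, Polynomial.taylor_X, Polynomial.taylor_C]
    ring
  change (Polynomial.taylor a _).gaussNorm (NormedField.toAbsoluteValue K) ρ = _
  rw [e]
  have hv : ∀ x : K, NormedField.toAbsoluteValue K x = ‖x‖ := fun _ => rfl
  apply le_antisymm
  · obtain ⟨i, hi⟩ := Polynomial.exists_eq_gaussNorm (NormedField.toAbsoluteValue K) ρ
      (Polynomial.X + Polynomial.C (a - b))
    rw [hi, hv]
    rcases i with _ | _ | i
    · simp
    · simp
    · simp [Polynomial.coeff_X]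
  · have h0 := Polynomial.le_gaussNorm (NormedField.toAbsoluteValue K)
      (Polynomial.X + Polynomial.C (a - b)) hρ.le 0
    have h1 := Polynomial.le_gaussNorm (NormedField.toAbsoluteValue K)
      (Polynomial.X + Polynomial.C (a - b)) hρ.le 1
    rw [hv] at h0 h1
    refine max_le ?_ ?_
    · simpa using h0
    · simpa [Polynomial.coeff_C] using h1

theorem sphericalRadius_diskPoint (a : K) (ρ : ℝ) (hρ : 0 < ρ) :
    (diskPoint a ρ hρ).sphericalRadius = ρ / max 1 (max (ρ ^ 2) (‖a‖ ^ 2)) := by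
  have h1 : (⨅ b : K, diskPoint a ρ hρ (Polynomial.X - Polynomial.C b)) = ρ := by
    simp only [diskPoint_X_sub_C]
    refine le_antisymm ?_ (le_ciInf fun b => le_max_right _ _)
    refine (ciInf_le ⟨ρ, ?_⟩ a).trans (by simp [hρ.le])
    rintro _ ⟨b, rfl⟩
    exact le_max_right _ _
  have h2 : diskPoint a ρ hρ Polynomial.X = max ‖a‖ ρ := by
    simpa using diskPoint_X_sub_C a 0 ρ hρ
  rw [sphericalRadius, h1, h2]
  congr 2
  rcases le_total ‖a‖ ρ with h | h
  · rw [max_eq_right h, max_eq_left (by gcongr)]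
  · rw [max_eq_left h, max_eq_right (by gcongr)]

/-- `x` and `y` in `ℙ¹(K) = K ∪ {∞}` lie in different connected components of the Berkovich
projective line with the point `ν₁` removed. -/
def Separates (ν₁ : OnePoint (BerkovichLine K)) (x y : OnePoint K) : Prop :=
  OnePoint.map typeI x ≠ ν₁ ∧ OnePoint.map typeI y ≠ ν₁ ∧
    connectedComponentIn {ν₁}ᶜ (OnePoint.map typeI x) ≠
      connectedComponentIn {ν₁}ᶜ (OnePoint.map typeI y)

end Ultrametric

end BerkovichLine

open Classical in
/-- The map `K → ℙ¹(K) = K ∪ {∞}` given by a rational function. -/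
noncomputable def ratFuncToP1 {K : Type*} [NormedField K] (f : RatFunc K) (x : K) : OnePoint K :=
  if f.denom.eval x = 0 then OnePoint.infty
  else OnePoint.some (f.num.eval x / f.denom.eval x)

/-- A (bounded) disk in `K`, open or closed. -/
def IsDisk {K : Type*} [NormedField K] (U : Set K) : Prop :=
  ∃ (x : K) (ρ : ℝ), 0 < ρ ∧ (U = Metric.ball x ρ ∨ U = Metric.closedBall x ρ)

/-- `f` maps the set `U` one-to-one onto `V`. -/
def MapsOneToOneOnto {K : Type*} [NormedField K] (f : RatFunc K) (U : Set K)
    (V : Set (OnePoint K)) : Prop :=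
  Set.InjOn (ratFuncToP1 f) U ∧ ratFuncToP1 f '' U = V

/-- `a_0 = 0`, `|a_i| = 1` for `i ≠ 0`, and `|a_i - a_j| = 1` for `i ≠ j`. -/
def IsIslandCenters {K : Type*} [NormedField K] {N : ℕ} (a : Fin (N + 1) → K) : Prop :=
  a 0 = 0 ∧ (∀ i, i ≠ 0 → ‖a i‖ = 1) ∧ ∀ i j, i ≠ j → ‖a i - a j‖ = 1

/-- The `N + 2` islands: the open disks `D(a_i, s)`, and `ℙ¹(K)` minus the closed disk of
radius `1 / s` about `0`. -/
def island {K : Type*} [NormedField K] {N : ℕ} (a : Fin (N + 1) → K) (s : ℝ) :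
    Option (Fin (N + 1)) → Set (OnePoint K)
  | some i => OnePoint.some '' Metric.ball (a i) s
  | none => (OnePoint.some '' Metric.closedBall (0 : K) (1 / s))ᶜ

/-- `f = (z + c / z ^ q) ∏_{i=1}^N (1 + c / (z - a_i) ^ q)`. -/
noncomputable def warpFunction {K : Type*} [NormedField K] {N : ℕ} (a : Fin (N + 1) → K)
    (q : ℕ) (c : K) : RatFunc K :=
  (RatFunc.X + RatFunc.C c / RatFunc.X ^ q) *
    ∏ i : Fin N, (1 + RatFunc.C c / (RatFunc.X - RatFunc.C (a i.succ)) ^ q)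

/-! Put `q = p ^ n` and `f = P / Q` with `Q = ∏ (X - a_i) ^ q`. Expanding the product gives `P = X *
Q + c * R` with `‖R‖ ≤ 1` at the Gauss point, so there `f` is a small perturbation of the identity:
it fixes `ν₁`. Its Wronskian is `Q ^ 2` plus a multiple of `c`, hence has norm `1`, and `L(f, ν₁) =
1` (`map_warpFunction`, `boundaryLength_warpFunction`).

The perturbation is nevertheless felt at the poles `a_j`, which have order `q`. Outside the disks
`D(a_j, s)` one has `|c / (x - a_k) ^ q| ≤ |b|`, so `f(x)` stays close to `x`; thus a point with
value in a bounded island lies within `s` of some `a_j` (`exists_norm_sub_lt`). There,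
differentiating `c / (z - a_j) ^ q` produces the small factor `q`, and `|f'(x)| |x - a_j| ≤ max(|x -
a_j|, |q|) < s` (`norm_sum_warpFactorDeriv_le`). A disk `U` mapped injectively scales distances from
`x` by `|f'(x)|` (`IsDisk.norm_cross_eq`), and a disk `U` mapped onto a bounded island misses the
pole `a_j`, so its points are at distance less than `|x - a_j|` from `x`. Its image therefore stays
within a radius smaller than `s` about `f(x)` and cannot fill the island.

A disk mapped onto the unbounded island contains a pole. Its order `q ≥ 2` contradicts the same
scaling law.

The separation of the islands holds because each residue class is open and closed in the complement
of the Gauss point. -/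

/-! ### Ultrametric preliminaries and existence of the centers. -/

theorem norm_add_eq_left_of_lt {K : Type*} [NormedField K] [IsUltrametricDist K] {x y : K}
    (h : ‖y‖ < ‖x‖) : ‖x + y‖ = ‖x‖ := by
  rw [IsUltrametricDist.norm_add_eq_max_of_norm_ne_norm h.ne', max_eq_left h.le]

theorem norm_sub_le_max' {K : Type*} [NormedField K] [IsUltrametricDist K] (x y : K) :
    ‖x - y‖ ≤ max ‖x‖ ‖y‖ := by
  simpa [sub_eq_add_neg] using IsUltrametricDist.norm_add_le_max x (-y)

theorem Polynomial.linear_factor_induction {K : Type*} [Field K] [IsAlgClosed K]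
    {M : K[X] → Prop} (hC : ∀ c, M (Polynomial.C c))
    (hmul : ∀ b g, M g → M ((Polynomial.X - Polynomial.C b) * g)) (g : K[X]) : M g := by
  rw [(IsAlgClosed.splits g).eq_prod_roots, mul_comm]
  induction g.roots using Multiset.induction with
  | empty => simpa using hC _
  | cons b t ih => simpa [mul_assoc] using hmul b _ ih

/-- The value group is divisible, hence dense: a high root `w` of an element of norm above `1` has
norm so close to `1` that some power of it falls between `r` and `s`. -/
theorem exists_norm_between {K : Type*} [NontriviallyNormedField K] [IsAlgClosed K] {r s : ℝ}
    (hr : 0 < r) (hrs : r < s) : ∃ x : K, r < ‖x‖ ∧ ‖x‖ < s := by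
  obtain ⟨u, hu⟩ := NormedField.exists_one_lt_norm K
  have hsr : 1 < s / r := (one_lt_div hr).2 hrs
  obtain ⟨k, hk⟩ := pow_unbounded_of_one_lt ‖u‖ hsr
  have hk0 : k ≠ 0 := by
    rintro rfl
    simp only [pow_zero] at hk
    linarith
  obtain ⟨w, rfl⟩ := IsAlgClosed.exists_pow_nat_eq u (Nat.pos_of_ne_zero hk0)
  rw [norm_pow] at hu hk
  have h1 : 1 < ‖w‖ := by
    by_contra! h
    exact absurd hu (not_lt.2 (pow_le_one₀ (norm_nonneg _) h))
  have h2 : ‖w‖ < s / r := lt_of_pow_lt_pow_left₀ k (by positivity) hk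
  obtain ⟨n, hn⟩ := exists_mem_Ico_zpow hr h1
  refine ⟨w ^ (n + 1), ?_, ?_⟩
  · rw [norm_zpow]; exact hn.2
  · rw [norm_zpow, zpow_add_one₀ (by positivity)]
    calc ‖w‖ ^ n * ‖w‖ ≤ r * ‖w‖ := by gcongr; exact hn.1
      _ < r * (s / r) := by gcongr
      _ = s := by field_simp

theorem exists_isIslandCenters (K : Type*) [NontriviallyNormedField K] [IsUltrametricDist K]
    [IsAlgClosed K] (N : ℕ) : ∃ a : Fin (N + 1) → K, IsIslandCenters a := by
  induction N with
  | zero => exact ⟨fun _ => 0, rfl, fun i hi => absurd (Fin.fin_one_eq_zero i) hi,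
      fun i j hij => absurd ((Fin.fin_one_eq_zero i).trans (Fin.fin_one_eq_zero j).symm) hij⟩
  | succ N ih =>
    obtain ⟨a, h0, h1, h2⟩ := ih
    have ha : ∀ i, ‖a i‖ ≤ 1 := fun i => by
      rcases eq_or_ne i 0 with rfl | hi
      · simp [h0]
      · exact (h1 i hi).le
    -- A root of `∏ (X - a_i) - 1` is the next center: the numbers `|x - a_i|` are at most `1` and
    -- have product `1`, so each of them equals `1`.
    obtain ⟨x, hx⟩ := IsAlgClosed.exists_root
      ((∏ i, (Polynomial.X - Polynomial.C (a i))) - 1 : K[X]) (by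
        have hd : (∏ i, (Polynomial.X - Polynomial.C (a i)) : K[X]).degree = (N + 1 : ℕ) := by
          rw [Polynomial.degree_prod]
          simp
        rw [Polynomial.degree_sub_eq_left_of_degree_lt]
        · rw [hd]
          exact_mod_cast Nat.succ_ne_zero N
        · rw [hd, Polynomial.degree_one]
          exact_mod_cast Nat.succ_pos N)
    have hp : ∏ i, ‖x - a i‖ = 1 := by
      rw [← norm_prod]
      simp only [Polynomial.IsRoot, Polynomial.eval_sub, Polynomial.eval_prod,
        Polynomial.eval_X, Polynomial.eval_C, Polynomial.eval_one, sub_eq_zero] at hx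
      rw [hx, norm_one]
    have hx1 : ‖x‖ ≤ 1 := by
      by_contra! h
      have hxa : ∀ i, ‖x - a i‖ = ‖x‖ := fun i => by
        rw [sub_eq_add_neg]
        exact norm_add_eq_left_of_lt (by rw [norm_neg]; exact (ha i).trans_lt h)
      simp only [hxa, Finset.prod_const, Finset.card_univ, Fintype.card_fin] at hp
      exact (one_lt_pow₀ h (Nat.succ_ne_zero N)).ne' hp
    have hle : ∀ i, ‖x - a i‖ ≤ 1 := fun i => (norm_sub_le_max' _ _).trans (max_le hx1 (ha i))
    have hxa : ∀ i, ‖x - a i‖ = 1 := fun i => by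
      refine le_antisymm (hle i) ?_
      rw [← hp, ← Finset.mul_prod_erase _ _ (Finset.mem_univ i)]
      exact mul_le_of_le_one_right (norm_nonneg _)
        (Finset.prod_le_one (fun _ _ => norm_nonneg _) fun j _ => hle j)
    have hxn : ‖x‖ = 1 := by simpa [h0] using hxa 0
    refine ⟨Fin.snoc a x, ?_, ?_, ?_⟩
    · have : (0 : Fin (N + 2)) = Fin.castSucc 0 := rfl
      rw [this, Fin.snoc_castSucc, h0]
    · intro i hi
      induction i using Fin.lastCases with
      | last => simpa using hxn
      | cast i =>
        rw [Fin.snoc_castSucc]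
        exact h1 i (by rintro rfl; exact hi rfl)
    · intro i j hij
      induction i using Fin.lastCases with
      | last =>
        induction j using Fin.lastCases with
        | last => exact absurd rfl hij
        | cast j => simpa using hxa j
      | cast i =>
        induction j using Fin.lastCases with
        | last => simpa [norm_sub_rev] using hxa i
        | cast j => simpa using h2 i j (by rintro rfl; exact hij rfl)

theorem IsIslandCenters.norm_le_one {K : Type*} [NormedField K] {N : ℕ} {a : Fin (N + 1) → K}
    (ha : IsIslandCenters a) (i : Fin (N + 1)) : ‖a i‖ ≤ 1 := by
  rcases eq_or_ne i 0 with rfl | hi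
  · simp [ha.1]
  · exact (ha.2.1 i hi).le

theorem norm_natCast_lt_one_of_charP_residueField {K : Type*} [NormedField K]
    [IsUltrametricDist K] (p : ℕ)
    [CharP (IsLocalRing.ResidueField (NormedField.valuation (K := K)).valuationSubring) p] :
    ‖(p : K)‖ < 1 := by
  have h : IsLocalRing.residue (NormedField.valuation (K := K)).valuationSubring (p : _) = 0 := by
    rw [map_natCast]
    exact CharP.cast_eq_zero _ p
  rw [IsLocalRing.residue_eq_zero_iff, Valuation.mem_maximalIdeal_iff] at h
  have h' : NormedField.valuation (p : K) < 1 := by simpa using h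
  exact_mod_cast h'

/-! ### Seminorms, and the Gauss norm in terms of coefficients. -/

namespace BerkovichLine

section NormedField

variable {K : Type*} [NormedField K]

theorem ext_fun {ν μ : BerkovichLine K} (h : ∀ g, ν g = μ g) : ν = μ := by
  cases ν; cases μ
  congr
  exact funext h

/-- Over an algebraically closed field every polynomial splits, so multiplicativity leaves only
linear factors to compare. -/
theorem ext_linear [IsAlgClosed K] {ν μ : BerkovichLine K}
    (h : ∀ b, ν (Polynomial.X - Polynomial.C b) = μ (Polynomial.X - Polynomial.C b)) :
    ν = μ := by
  refine ext_fun fun g => ?_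
  induction g using Polynomial.linear_factor_induction with
  | hC c => rw [ν.map_C', μ.map_C']
  | hmul b g ih => rw [ν.map_mul', μ.map_mul', h, ih]

theorem map_sub_le (ν : BerkovichLine K) (g h : K[X]) : ν (g - h) ≤ max (ν g) (ν h) := by
  simpa [sub_eq_add_neg, ν.map_neg] using ν.map_add_le' g (-h)

theorem map_add_eq_left_of_lt (ν : BerkovichLine K) {g h : K[X]} (hlt : ν h < ν g) :
    ν (g + h) = ν g := by
  refine le_antisymm ((ν.map_add_le' g h).trans (max_eq_left hlt.le).le) ?_
  by_contra! hc
  have := ν.map_sub_le (g + h) h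
  rw [add_sub_cancel_right] at this
  exact absurd this (not_le.2 (max_lt hc hlt))

theorem map_pow' (ν : BerkovichLine K) (g : K[X]) (n : ℕ) : ν (g ^ n) = ν g ^ n := by
  induction n with
  | zero => simpa using ν.map_one
  | succ n ih => rw [pow_succ, pow_succ, ν.map_mul', ih]

theorem map_prod' {ι : Type*} (ν : BerkovichLine K) (t : Finset ι) (g : ι → K[X]) :
    ν (∏ i ∈ t, g i) = ∏ i ∈ t, ν (g i) := by
  classical
  induction t using Finset.induction_on with
  | empty => simpa using ν.map_one
  | insert i t hi ih => rw [Finset.prod_insert hi, Finset.prod_insert hi, ν.map_mul', ih]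

theorem ratNorm_div (ν : BerkovichLine K) (P Q : K[X]) (hQ : ν Q ≠ 0) :
    ν.ratNorm (algebraMap K[X] (RatFunc K) P / algebraMap K[X] (RatFunc K) Q) = ν P / ν Q := by
  have hQ0 : Q ≠ 0 := by rintro rfl; exact hQ ν.map_zero
  set f := algebraMap K[X] (RatFunc K) P / algebraMap K[X] (RatFunc K) Q with hf
  have hd : ν f.denom ≠ 0 := ν.map_ne_zero_of_dvd (RatFunc.denom_div_dvd P Q) hQ
  have h : f.num * Q = P * f.denom := (RatFunc.num_mul_eq_mul_denom_iff hQ0).2 hf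
  have h' := congrArg ν.toFun h
  rw [ν.map_mul', ν.map_mul'] at h'
  rw [ratNorm, div_eq_div_iff hd hQ]
  exact h'

end NormedField

section Ultrametric

variable {K : Type*} [NormedField K] [IsUltrametricDist K]

theorem diskPoint_zero_one_eq_zero_iff (g : K[X]) :
    diskPoint (0 : K) 1 one_pos g = 0 ↔ g = 0 := by
  change (Polynomial.taylor 0 g).gaussNorm (NormedField.toAbsoluteValue K) 1 = 0 ↔ _
  rw [Polynomial.gaussNorm_eq_zero_iff _ _ (fun x hx => by simpa using hx) one_pos,
    Polynomial.taylor_zero]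

theorem norm_coeff_le_diskPoint_zero_one (g : K[X]) (i : ℕ) :
    ‖g.coeff i‖ ≤ diskPoint (0 : K) 1 one_pos g := by
  change _ ≤ (Polynomial.taylor 0 g).gaussNorm (NormedField.toAbsoluteValue K) 1
  rw [Polynomial.taylor_zero]
  have h := Polynomial.le_gaussNorm (NormedField.toAbsoluteValue K) g zero_le_one i
  rwa [one_pow, mul_one] at h

/-- Differentiation multiplies coefficients by integers, which have norm at most `1`. -/
theorem diskPoint_zero_one_derivative_le (g : K[X]) :
    diskPoint (0 : K) 1 one_pos (Polynomial.derivative g) ≤ diskPoint (0 : K) 1 one_pos g := by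
  obtain ⟨i, hi⟩ := Polynomial.exists_eq_gaussNorm (NormedField.toAbsoluteValue K) 1
    (Polynomial.taylor 0 (Polynomial.derivative g))
  change (Polynomial.taylor 0 _).gaussNorm (NormedField.toAbsoluteValue K) 1 ≤ _
  rw [hi, one_pow, mul_one, Polynomial.taylor_zero, Polynomial.coeff_derivative]
  change ‖_‖ ≤ _
  rw [norm_mul]
  have h1 : ‖((i : K) + 1)‖ ≤ 1 := by
    exact_mod_cast IsUltrametricDist.norm_natCast_le_one K (i + 1)
  exact (mul_le_of_le_one_right (norm_nonneg _) h1).trans (norm_coeff_le_diskPoint_zero_one g _)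

end Ultrametric

end BerkovichLine

/-! ### Compactness of Berkovich disks and separation of the islands. -/

namespace BerkovichLine

section Compactness

variable {K : Type*} [NormedField K]

theorem continuous_eval (g : K[X]) : Continuous fun ν : BerkovichLine K => ν g :=
  (continuous_apply g).comp continuous_induced_dom

theorem exists_bound_of_map_X_sub_C_le_one [IsAlgClosed K] (a : K) (g : K[X]) :
    ∃ B, ∀ ν : BerkovichLine K, ν (Polynomial.X - Polynomial.C a) ≤ 1 → ν g ≤ B := by
  induction g using Polynomial.linear_factor_induction with
  | hC c => exact ⟨‖c‖, fun ν _ => (ν.map_C' c).le⟩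
  | hmul b g ih =>
    obtain ⟨B, hB⟩ := ih
    refine ⟨max 1 ‖a - b‖ * B, fun ν hν => ?_⟩
    rw [ν.map_mul']
    refine mul_le_mul ?_ (hB ν hν) (ν.nonneg g) (by positivity)
    have h := ν.map_add_le' (Polynomial.X - Polynomial.C a) (Polynomial.C (a - b))
    rw [ν.map_C', Polynomial.C_sub, sub_add_sub_cancel] at h
    exact h.trans (max_le_max_right _ hν)

theorem isClosed_setOf_map_X_sub_C_le_one (a : K) :
    IsClosed {ν : BerkovichLine K | ν (Polynomial.X - Polynomial.C a) ≤ 1} :=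
  isClosed_le (continuous_eval _) continuous_const

/-- Tychonoff: the seminorms in question form a subset of a product of intervals, cut out by closed
conditions. Compactness makes the complement, with `∞` added, open in the projective line. -/
theorem isCompact_setOf_map_X_sub_C_le_one [IsAlgClosed K] (a : K) :
    IsCompact {ν : BerkovichLine K | ν (Polynomial.X - Polynomial.C a) ≤ 1} := by
  choose B hB using exists_bound_of_map_X_sub_C_le_one a
  rw [(Topology.IsInducing.mk rfl : Topology.IsInducing (toFun (K := K))).isCompact_iff]
  refine (isCompact_univ_pi fun g => isCompact_Icc (a := 0) (b := B g)).of_isClosed_subset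
    ?_ ?_
  · have : toFun '' {ν : BerkovichLine K | ν (Polynomial.X - Polynomial.C a) ≤ 1} =
        ((⋂ c : K, {F : K[X] → ℝ | F (Polynomial.C c) = ‖c‖}) ∩
        (⋂ g : K[X], ⋂ h : K[X], {F : K[X] → ℝ | F (g * h) = F g * F h})) ∩
        ((⋂ g : K[X], ⋂ h : K[X], {F : K[X] → ℝ | F (g + h) ≤ max (F g) (F h)}) ∩
        {F : K[X] → ℝ | F (Polynomial.X - Polynomial.C a) ≤ 1}) := by
      ext F
      simp only [Set.mem_image, Set.mem_inter_iff, Set.mem_iInter, Set.mem_ofPred_eq]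
      constructor
      · rintro ⟨ν, hν, rfl⟩
        exact ⟨⟨ν.map_C', ν.map_mul'⟩, ν.map_add_le', hν⟩
      · rintro ⟨⟨h1, h2⟩, h3, h4⟩
        exact ⟨⟨F, h1, h2, h3⟩, h4, rfl⟩
    rw [this]
    refine ((isClosed_iInter fun c => ?_).inter
      (isClosed_iInter fun g => isClosed_iInter fun h => ?_)).inter
      ((isClosed_iInter fun g => isClosed_iInter fun h => ?_).inter ?_)
    · exact isClosed_eq (continuous_apply _) continuous_const
    · exact isClosed_eq (continuous_apply _) ((continuous_apply g).mul (continuous_apply h))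
    · exact isClosed_le (continuous_apply _) ((continuous_apply g).max (continuous_apply h))
    · exact isClosed_le (continuous_apply _) continuous_const
  · rintro _ ⟨ν, hν, rfl⟩ g -
    exact ⟨ν.nonneg g, hB g ν hν⟩

end Compactness

section Separation

variable {K : Type*} [NormedField K] [IsUltrametricDist K]

theorem typeI_X_sub_C (x a : K) : typeI x (Polynomial.X - Polynomial.C a) = ‖x - a‖ := by
  change ‖Polynomial.eval x _‖ = _
  simp

theorem map_typeI_ne_diskPoint (x : OnePoint K) (a : K) {ρ : ℝ} (hρ : 0 < ρ) :
    OnePoint.map typeI x ≠ (diskPoint a ρ hρ : OnePoint (BerkovichLine K)) := by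
  induction x using OnePoint.rec with
  | infty => simp
  | coe x =>
    rw [OnePoint.map_some, ne_eq, OnePoint.coe_eq_coe]
    intro h
    have h1 := typeI_X_sub_C x x
    rw [h, diskPoint_X_sub_C, sub_self, norm_zero] at h1
    exact absurd (h1 ▸ le_max_right ‖a - x‖ ρ) (not_le.2 hρ)

/-- A residue class of the Gauss point is open and closed in the complement of that point. -/
theorem separates_of_mem_ball [IsAlgClosed K] {a : K} (ha : ‖a‖ ≤ 1) {x y : OnePoint K}
    (hx : x ∈ OnePoint.some '' Metric.ball a 1) (hy : y ∉ OnePoint.some '' Metric.ball a 1) :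
    Separates (diskPoint (0 : K) 1 one_pos : OnePoint (BerkovichLine K)) x y := by
  refine ⟨map_typeI_ne_diskPoint _ _ _, map_typeI_ne_diskPoint _ _ _, fun heq => ?_⟩
  set ν₁ := diskPoint (0 : K) 1 one_pos with hν₁
  set F : Set (OnePoint (BerkovichLine K)) := {(ν₁ : OnePoint (BerkovichLine K))}ᶜ with hF
  have hxF : OnePoint.map typeI x ∈ F := map_typeI_ne_diskPoint _ _ _
  have hyF : OnePoint.map typeI y ∈ F := map_typeI_ne_diskPoint _ _ _
  have hyC : OnePoint.map typeI y ∈ connectedComponentIn F (OnePoint.map typeI x) :=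
    heq ▸ mem_connectedComponentIn hyF
  let D : K → Set (BerkovichLine K) := fun b => {ν | ν (Polynomial.X - Polynomial.C b) < 1}
  have hD : ∀ b, IsOpen (D b) := fun b => isOpen_lt (continuous_eval _) continuous_const
  let U : Set (OnePoint (BerkovichLine K)) := OnePoint.some '' D a
  -- `V` consists of `∞`, the points beyond the closed unit disk about `a`, and the open unit disks
  -- around all `b` outside `D(a, 1)`.
  let V : Set (OnePoint (BerkovichLine K)) :=
    (OnePoint.some '' {ν : BerkovichLine K | ν (Polynomial.X - Polynomial.C a) ≤ 1})ᶜ ∪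
      OnePoint.some '' ⋃ b ∈ {b : K | 1 ≤ ‖a - b‖}, D b
  have hU : IsOpen U := OnePoint.isOpen_image_coe.2 (hD a)
  have hV : IsOpen V := (OnePoint.isOpen_compl_image_coe.2
    ⟨isClosed_setOf_map_X_sub_C_le_one a, isCompact_setOf_map_X_sub_C_le_one a⟩).union
    (OnePoint.isOpen_image_coe.2 (isOpen_biUnion fun b _ => hD b))
  have hUV : U ∩ V = ∅ := by
    rw [Set.eq_empty_iff_forall_notMem]
    rintro _ ⟨⟨ν, hν, rfl⟩, h | ⟨μ, hμ, h⟩⟩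
    · exact h ⟨ν, le_of_lt (show ν (Polynomial.X - Polynomial.C a) < 1 from hν), rfl⟩
    · rw [OnePoint.coe_eq_coe] at h
      subst h
      simp only [Set.mem_iUnion] at hμ
      obtain ⟨b, hb, hbμ⟩ := hμ
      have h := μ.map_sub_le (Polynomial.X - Polynomial.C b) (Polynomial.X - Polynomial.C a)
      rw [sub_sub_sub_cancel_left, ← Polynomial.C_sub, μ.map_C'] at h
      exact absurd (hb.trans h) (not_le.2 (max_lt hbμ hν))
  have hcover : F ⊆ U ∪ V := by
    intro z hz
    induction z using OnePoint.rec with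
    | infty => exact Or.inr (Or.inl (by simp))
    | coe ν =>
      -- A point in neither set satisfies `‖X - a‖ = 1` and `‖X - b‖ ≥ 1` whenever `|a - b| ≥ 1`.
      -- This fixes its value on every linear polynomial, so it is the Gauss point.
      by_contra hc
      apply hz
      rw [Set.mem_singleton_iff, OnePoint.coe_eq_coe]
      simp only [U, V, Set.mem_union, not_or, Set.mem_compl_iff, not_not] at hc
      obtain ⟨h1, h2, h3⟩ := hc
      obtain ⟨μ, h2, hμ⟩ := h2
      rw [OnePoint.coe_eq_coe] at hμ
      subst hμ
      have h1' : 1 ≤ μ (Polynomial.X - Polynomial.C a) := by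
        by_contra! h
        exact h1 ⟨μ, h, rfl⟩
      have h3' : ∀ b, 1 ≤ ‖a - b‖ → 1 ≤ μ (Polynomial.X - Polynomial.C b) := by
        intro b hb
        by_contra! h
        exact h3 ⟨μ, Set.mem_biUnion (show b ∈ {b : K | 1 ≤ ‖a - b‖} from hb) h, rfl⟩
      refine ext_linear fun b => ?_
      rw [hν₁, diskPoint_X_sub_C, zero_sub, norm_neg]
      have e : (Polynomial.X - Polynomial.C b : K[X])
          = (Polynomial.X - Polynomial.C a) + Polynomial.C (a - b) := by
        rw [Polynomial.C_sub]; ring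
      have e' : (Polynomial.X - Polynomial.C b : K[X])
          = Polynomial.C (a - b) + (Polynomial.X - Polynomial.C a) := by
        rw [e, add_comm]
      have h2' : μ (Polynomial.X - Polynomial.C a) = 1 := le_antisymm h2 h1'
      rcases lt_trichotomy ‖a - b‖ 1 with h | h | h
      · rw [e, μ.map_add_eq_left_of_lt (by rwa [μ.map_C', h2']), h2', max_eq_right]
        have : b = a - (a - b) := by ring
        rw [this]
        exact (norm_sub_le_max' _ _).trans (max_le ha h.le)
      · have hb : ‖b‖ ≤ 1 := by
          have : b = a - (a - b) := by ring
          rw [this]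
          exact (norm_sub_le_max' _ _).trans (max_le ha h.le)
        rw [max_eq_right hb]
        refine le_antisymm ?_ (h3' b h.ge)
        rw [e]
        refine (μ.map_add_le' _ _).trans (max_le h2 ?_)
        rw [μ.map_C', h]
      · rw [e', μ.map_add_eq_left_of_lt (by rwa [μ.map_C', h2']), μ.map_C']
        have hb : ‖b‖ = ‖a - b‖ := by
          have : -b = (a - b) + (-a) := by ring
          rw [← norm_neg, this]
          exact norm_add_eq_left_of_lt (by rw [norm_neg]; exact ha.trans_lt h)
        rw [← hb, max_eq_left (by rw [hb]; exact h.le)]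
  have hsub := connectedComponentIn_subset F (OnePoint.map typeI x)
  have hpre : IsPreconnected (connectedComponentIn F (OnePoint.map typeI x)) :=
    isPreconnected_connectedComponentIn
  have hxU : OnePoint.map typeI x ∈ U := by
    obtain ⟨x, hx, rfl⟩ := hx
    refine ⟨typeI x, ?_, rfl⟩
    change typeI x (Polynomial.X - Polynomial.C a) < 1
    rw [typeI_X_sub_C]
    exact mem_ball_iff_norm.1 hx
  have hyV : OnePoint.map typeI y ∈ V := by
    refine (hcover hyF).resolve_left ?_
    rintro ⟨ν, hν, h⟩
    apply hy
    induction y using OnePoint.rec with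
    | infty => simp at h
    | coe y =>
      rw [OnePoint.map_some, OnePoint.coe_eq_coe] at h
      subst h
      refine ⟨y, mem_ball_iff_norm.2 ?_, rfl⟩
      rw [← typeI_X_sub_C]
      exact hν
  obtain ⟨z, -, hz⟩ := hpre U V hU hV (hsub.trans hcover)
    ⟨_, mem_connectedComponentIn hxF, hxU⟩ ⟨_, hyC, hyV⟩
  rw [hUV] at hz
  exact hz

theorem Separates.symm {ν : OnePoint (BerkovichLine K)} {x y : OnePoint K}
    (h : Separates ν x y) : Separates ν y x :=
  ⟨h.2.1, h.1, h.2.2.symm⟩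

theorem notMem_ball_of_mem_island {N : ℕ} {a : Fin (N + 1) → K} (ha : IsIslandCenters a)
    {s : ℝ} (hs : 0 < s) (hs1 : s ≤ 1) {i : Fin (N + 1)} {j : Option (Fin (N + 1))}
    (hij : some i ≠ j) {y : OnePoint K} (hy : y ∈ island a s j) :
    y ∉ OnePoint.some '' Metric.ball (a i) 1 := by
  rintro ⟨y, hyi, rfl⟩
  rw [mem_ball_iff_norm] at hyi
  cases j with
  | none =>
    refine hy ⟨y, ?_, rfl⟩
    rw [mem_closedBall_zero_iff]
    calc ‖y‖ = ‖(y - a i) + a i‖ := by rw [sub_add_cancel]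
      _ ≤ max ‖y - a i‖ ‖a i‖ := IsUltrametricDist.norm_add_le_max _ _
      _ ≤ 1 := max_le hyi.le (ha.norm_le_one i)
      _ ≤ 1 / s := by rwa [le_div_iff₀ hs, one_mul]
  | some j =>
    obtain ⟨y', hyj, h⟩ := hy
    rw [OnePoint.coe_eq_coe] at h
    subst h
    rw [mem_ball_iff_norm] at hyj
    have hne : j ≠ i := fun h => hij (by rw [h])
    have h := norm_sub_le_max' (y' - a i) (y' - a j)
    rw [sub_sub_sub_cancel_left, ha.2.2 j i hne] at h
    exact absurd h (not_le.2 (max_lt hyi (hyj.trans_le hs1)))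

theorem separates_of_mem_island [IsAlgClosed K] {N : ℕ} {a : Fin (N + 1) → K}
    (ha : IsIslandCenters a) {s : ℝ} (hs : 0 < s) (hs1 : s ≤ 1) {i j : Option (Fin (N + 1))}
    (hij : i ≠ j) {x y : OnePoint K} (hx : x ∈ island a s i) (hy : y ∈ island a s j) :
    Separates (diskPoint (0 : K) 1 one_pos : OnePoint (BerkovichLine K)) x y := by
  have key : ∀ (i : Fin (N + 1)) (j : Option (Fin (N + 1))), some i ≠ j → ∀ x ∈ island a s i,
      ∀ y ∈ island a s j,
      Separates (diskPoint (0 : K) 1 one_pos : OnePoint (BerkovichLine K)) x y :=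
    fun i j hij x hx y hy => separates_of_mem_ball (ha.norm_le_one i)
      (Set.image_mono (Metric.ball_subset_ball hs1) hx)
      (notMem_ball_of_mem_island ha hs hs1 hij hy)
  cases i with
  | some i => exact key i j hij x hx y hy
  | none =>
    cases j with
    | none => exact absurd rfl hij
    | some j => exact (key j none hij.symm y hy x hx).symm

end Separation

end BerkovichLine

/-! ### Fractions that need not be reduced, and the explicit numerator and denominator. -/

namespace RatFunc

variable {K : Type*} [Field K]

theorem num_mul_eq_mul_denom_of_eq_div {f : RatFunc K} {P Q : K[X]} (hQ : Q ≠ 0)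
    (hf : f = algebraMap K[X] (RatFunc K) P / algebraMap K[X] (RatFunc K) Q) :
    f.num * Q = P * f.denom :=
  (num_mul_eq_mul_denom_iff hQ).2 hf

end RatFunc

namespace BerkovichLine

/-- `ratDeriv` is defined through the reduced fraction; differentiating `f.num * Q = P * f.denom`
transfers the quotient rule to any representation. -/
theorem ratDeriv_div {K : Type*} [NormedField K] (P Q : K[X]) (hQ : Q ≠ 0) :
    ratDeriv (algebraMap K[X] (RatFunc K) P / algebraMap K[X] (RatFunc K) Q) =
      algebraMap K[X] (RatFunc K)
        (Polynomial.derivative P * Q - P * Polynomial.derivative Q) /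
      algebraMap K[X] (RatFunc K) (Q ^ 2) := by
  set f := algebraMap K[X] (RatFunc K) P / algebraMap K[X] (RatFunc K) Q with hf
  have h : f.num * Q = P * f.denom := RatFunc.num_mul_eq_mul_denom_of_eq_div hQ hf
  have h' := congrArg Polynomial.derivative h
  rw [Polynomial.derivative_mul, Polynomial.derivative_mul] at h'
  have hd := f.denom_ne_zero
  have hne : ∀ g : K[X], g ≠ 0 → algebraMap K[X] (RatFunc K) (g ^ 2) ≠ 0 := fun g hg =>
    RatFunc.algebraMap_ne_zero (pow_ne_zero 2 hg)
  rw [ratDeriv, div_eq_div_iff (hne _ hd) (hne _ hQ), ← _root_.map_mul, ← _root_.map_mul]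
  congr 1
  linear_combination (f.denom * Q) * h' -
    (Q * Polynomial.derivative f.denom + f.denom * Polynomial.derivative Q) * h

end BerkovichLine

section Warp

variable {K : Type*} [NormedField K] {N : ℕ}

/-- The numerator of `warpFunction a q c` over the common denominator `warpDenom a q`. -/
noncomputable def warpNum (a : Fin (N + 1) → K) (q : ℕ) (c : K) : K[X] :=
  (Polynomial.X ^ (q + 1) + Polynomial.C c) *
    ∏ i : Fin N, ((Polynomial.X - Polynomial.C (a i.succ)) ^ q + Polynomial.C c)

/-- The common denominator of the factors of `warpFunction a q c`. -/
noncomputable def warpDenom (a : Fin (N + 1) → K) (q : ℕ) : K[X] :=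
  ∏ i, (Polynomial.X - Polynomial.C (a i)) ^ q

theorem warpDenom_ne_zero (a : Fin (N + 1) → K) (q : ℕ) : warpDenom a q ≠ 0 :=
  Finset.prod_ne_zero_iff.2 fun _ _ => pow_ne_zero _ (Polynomial.X_sub_C_ne_zero _)

theorem IsIslandCenters.warpDenom_eq {a : Fin (N + 1) → K} (ha : IsIslandCenters a) (q : ℕ) :
    warpDenom a q = Polynomial.X ^ q *
      ∏ i : Fin N, (Polynomial.X - Polynomial.C (a i.succ)) ^ q := by
  rw [warpDenom, Fin.prod_univ_succ, ha.1, Polynomial.C_0, sub_zero]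

theorem IsIslandCenters.warpFunction_eq_div {a : Fin (N + 1) → K} (ha : IsIslandCenters a)
    (q : ℕ) (c : K) :
    warpFunction a q c = algebraMap K[X] (RatFunc K) (warpNum a q c) /
      algebraMap K[X] (RatFunc K) (warpDenom a q) := by
  have hX : (RatFunc.X : RatFunc K) ≠ 0 := RatFunc.X_ne_zero
  have hne : ∀ b : K, (RatFunc.X - RatFunc.C b : RatFunc K) ≠ 0 := fun b => by
    have := RatFunc.algebraMap_ne_zero (Polynomial.X_sub_C_ne_zero b)
    simpa using this
  rw [ha.warpDenom_eq, warpNum, warpFunction]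
  simp only [map_mul, map_prod, map_pow, map_add, map_sub, RatFunc.algebraMap_X,
    RatFunc.algebraMap_C]
  rw [mul_div_mul_comm, ← Finset.prod_div_distrib]
  congr 1
  · field_simp
    ring
  · refine Finset.prod_congr rfl fun i _ => ?_
    have := pow_ne_zero q (hne (a i.succ))
    field_simp

end Warp

/-! ### The behavior of the function at the Gauss point. -/

namespace BerkovichLine

variable {K : Type*} [NormedField K] [IsUltrametricDist K] {N : ℕ}

theorem diskPoint_zero_one_X_sub_C (b : K) :
    diskPoint (0 : K) 1 one_pos (Polynomial.X - Polynomial.C b) = max ‖b‖ 1 := by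
  rw [diskPoint_X_sub_C, zero_sub, norm_neg]

theorem diskPoint_zero_one_warpDenom {a : Fin (N + 1) → K} (ha : IsIslandCenters a) (q : ℕ) :
    diskPoint (0 : K) 1 one_pos (warpDenom a q) = 1 := by
  rw [warpDenom, map_prod']
  refine Finset.prod_eq_one fun i _ => ?_
  rw [map_pow', diskPoint_zero_one_X_sub_C, max_eq_right (ha.norm_le_one i), one_pow]

theorem exists_prod_pow_add_C_eq {ι : Type*} (t : Finset ι) (a : ι → K) (ha : ∀ i, ‖a i‖ ≤ 1)
    (q : ℕ) {c : K} (hc : ‖c‖ ≤ 1) :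
    ∃ R : K[X], diskPoint (0 : K) 1 one_pos R ≤ 1 ∧
      ∏ i ∈ t, ((Polynomial.X - Polynomial.C (a i)) ^ q + Polynomial.C c) =
        ∏ i ∈ t, (Polynomial.X - Polynomial.C (a i)) ^ q + Polynomial.C c * R := by
  classical
  induction t using Finset.induction_on with
  | empty => exact ⟨0, by simp [map_zero], by simp⟩
  | insert i t hi ih =>
    obtain ⟨R, hR, h⟩ := ih
    set ν₁ := diskPoint (0 : K) 1 one_pos
    have hX : ∀ i, ν₁ ((Polynomial.X - Polynomial.C (a i)) ^ q) = 1 := fun i => by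
      rw [map_pow', diskPoint_zero_one_X_sub_C, max_eq_right (ha i), one_pow]
    refine ⟨((Polynomial.X - Polynomial.C (a i)) ^ q + Polynomial.C c) * R +
      ∏ i ∈ t, (Polynomial.X - Polynomial.C (a i)) ^ q, ?_, ?_⟩
    · refine (ν₁.map_add_le' _ _).trans (max_le ?_ ?_)
      · rw [ν₁.map_mul']
        refine mul_le_one₀ ?_ (ν₁.nonneg _) hR
        refine (ν₁.map_add_le' _ _).trans (max_le (hX i).le ?_)
        rwa [ν₁.map_C']
      · rw [map_prod']
        exact (Finset.prod_eq_one fun i _ => hX i).le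
    · rw [Finset.prod_insert hi, Finset.prod_insert hi, h]
      ring

/-- The precise form of "`f` is the identity modulo `c`"; both `f_*(ν₁) = ν₁` and `L(f, ν₁) = 1` are
read off from it. -/
theorem exists_warpNum_eq {a : Fin (N + 1) → K} (ha : IsIslandCenters a) (q : ℕ) {c : K}
    (hc : ‖c‖ ≤ 1) :
    ∃ R : K[X], diskPoint (0 : K) 1 one_pos R ≤ 1 ∧
      warpNum a q c = Polynomial.X * warpDenom a q + Polynomial.C c * R := by
  obtain ⟨R, hR, h⟩ := exists_prod_pow_add_C_eq Finset.univ (fun i : Fin N => a i.succ)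
    (fun i => ha.norm_le_one _) q hc
  set ν₁ := diskPoint (0 : K) 1 one_pos
  have hX : ∀ b : K, ‖b‖ ≤ 1 → ν₁ (Polynomial.X - Polynomial.C b) = 1 := fun b hb => by
    rw [diskPoint_zero_one_X_sub_C, max_eq_right hb]
  have hX0 : ν₁ Polynomial.X = 1 := by simpa using hX 0 (by simp)
  refine ⟨Polynomial.X ^ (q + 1) * R + Polynomial.C c * R +
    ∏ i : Fin N, (Polynomial.X - Polynomial.C (a i.succ)) ^ q, ?_, ?_⟩
  · refine (ν₁.map_add_le' _ _).trans (max_le ((ν₁.map_add_le' _ _).trans (max_le ?_ ?_)) ?_)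
    · rwa [ν₁.map_mul', map_pow', hX0, one_pow, one_mul]
    · rw [ν₁.map_mul', ν₁.map_C']
      exact mul_le_one₀ hc (ν₁.nonneg _) hR
    · rw [map_prod']
      refine (Finset.prod_eq_one fun i _ => ?_).le
      rw [map_pow', hX _ (ha.norm_le_one _), one_pow]
  · rw [warpNum, h, ha.warpDenom_eq]
    ring

theorem diskPoint_zero_one_C_mul_lt {R : K[X]} (hR : diskPoint (0 : K) 1 one_pos R ≤ 1)
    {c : K} (hc : ‖c‖ < 1) : diskPoint (0 : K) 1 one_pos (Polynomial.C c * R) < 1 := by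
  rw [map_mul', map_C']
  exact (mul_le_of_le_one_right (norm_nonneg _) hR).trans_lt hc

theorem diskPoint_zero_one_wronskian {a : Fin (N + 1) → K} (ha : IsIslandCenters a) (q : ℕ)
    {c : K} (hc : ‖c‖ < 1) :
    diskPoint (0 : K) 1 one_pos (Polynomial.derivative (warpNum a q c) * warpDenom a q -
      warpNum a q c * Polynomial.derivative (warpDenom a q)) = 1 := by
  obtain ⟨R, hR, h⟩ := exists_warpNum_eq ha q hc.le
  have hQ := diskPoint_zero_one_warpDenom ha q
  set ν₁ := diskPoint (0 : K) 1 one_pos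
  set Q := warpDenom a q
  -- The term `X * Q` of the numerator contributes exactly `Q ^ 2`, of norm `1`; everything else
  -- carries the factor `c`.
  have e : Polynomial.derivative (warpNum a q c) * Q -
      warpNum a q c * Polynomial.derivative Q = Q ^ 2 +
      Polynomial.C c * (Polynomial.derivative R * Q - R * Polynomial.derivative Q) := by
    rw [h]
    simp only [Polynomial.derivative_add, Polynomial.derivative_mul, Polynomial.derivative_X,
      Polynomial.derivative_C]
    ring
  have hQ2 : ν₁ (Q ^ 2) = 1 := by rw [map_pow', hQ, one_pow]
  rw [e, map_add_eq_left_of_lt, hQ2]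
  rw [hQ2]
  refine diskPoint_zero_one_C_mul_lt ((ν₁.map_sub_le _ _).trans (max_le ?_ ?_)) hc
  · rw [ν₁.map_mul', hQ, mul_one]
    exact (diskPoint_zero_one_derivative_le R).trans hR
  · rw [ν₁.map_mul']
    exact mul_le_one₀ hR (ν₁.nonneg _) ((diskPoint_zero_one_derivative_le Q).trans hQ.le)

theorem diskPoint_zero_one_denom_ne_zero (f : RatFunc K) :
    diskPoint (0 : K) 1 one_pos f.denom ≠ 0 :=
  fun h => f.denom_ne_zero ((diskPoint_zero_one_eq_zero_iff _).1 h)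

theorem ratNorm_warpFunction_sub_C {a : Fin (N + 1) → K} (ha : IsIslandCenters a) (q : ℕ)
    {c : K} (hc : ‖c‖ < 1) (b : K) :
    (diskPoint (0 : K) 1 one_pos).ratNorm (warpFunction a q c - RatFunc.C b) = max ‖b‖ 1 := by
  obtain ⟨R, hR, h⟩ := exists_warpNum_eq ha q hc.le
  have hQ := diskPoint_zero_one_warpDenom ha q
  have hQ0 := RatFunc.algebraMap_ne_zero (warpDenom_ne_zero a q)
  have hf := ha.warpFunction_eq_div q c
  have e : warpFunction a q c - RatFunc.C b = algebraMap K[X] (RatFunc K)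
      ((Polynomial.X - Polynomial.C b) * warpDenom a q + Polynomial.C c * R) /
      algebraMap K[X] (RatFunc K) (warpDenom a q) := by
    rw [hf, eq_div_iff hQ0, sub_mul, div_mul_cancel₀ _ hQ0, h, ← RatFunc.algebraMap_C,
      ← _root_.map_mul, ← _root_.map_sub]
    congr 1
    ring
  rw [e, ratNorm_div _ _ _ (by rw [hQ]; exact one_ne_zero), hQ, div_one]
  have hl : diskPoint (0 : K) 1 one_pos ((Polynomial.X - Polynomial.C b) * warpDenom a q) =
      max ‖b‖ 1 := by
    rw [map_mul', hQ, mul_one, diskPoint_zero_one_X_sub_C]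
  rw [map_add_eq_left_of_lt, hl]
  rw [hl]
  exact (diskPoint_zero_one_C_mul_lt hR hc).trans_le (le_max_right _ _)

theorem map_warpFunction [IsAlgClosed K] {a : Fin (N + 1) → K} (ha : IsIslandCenters a) (q : ℕ)
    {c : K} (hc : ‖c‖ < 1) :
    map (warpFunction a q c) (diskPoint (0 : K) 1 one_pos) =
      (diskPoint (0 : K) 1 one_pos : OnePoint (BerkovichLine K)) := by
  rw [map, dif_neg (diskPoint_zero_one_denom_ne_zero _), OnePoint.coe_eq_coe]
  refine ext_linear fun b => ?_
  rw [diskPoint_zero_one_X_sub_C, ← ratNorm_warpFunction_sub_C ha q hc b]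
  change ratNorm _ _ = _
  rw [_root_.map_sub, Polynomial.aeval_X, Polynomial.aeval_C, RatFunc.algebraMap_eq_C]

theorem boundaryLength_warpFunction {a : Fin (N + 1) → K} (ha : IsIslandCenters a) (q : ℕ)
    {c : K} (hc : ‖c‖ < 1) :
    boundaryLength (warpFunction a q c) (diskPoint (0 : K) 1 one_pos) = 1 := by
  have hQ := diskPoint_zero_one_warpDenom ha q
  have h1 : (diskPoint (0 : K) 1 one_pos).ratNorm (warpFunction a q c) = 1 := by
    simpa using ratNorm_warpFunction_sub_C ha q hc 0
  have h2 : (diskPoint (0 : K) 1 one_pos).ratNorm (ratDeriv (warpFunction a q c)) = 1 := by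
    rw [ha.warpFunction_eq_div, ratDeriv_div _ _ (warpDenom_ne_zero a q),
      ratNorm_div _ _ _ (by rw [map_pow', hQ]; simp), diskPoint_zero_one_wronskian ha q hc,
      map_pow', hQ]
    norm_num
  rw [boundaryLength, sphericalRadius_diskPoint, sphericalDeriv,
    if_neg (diskPoint_zero_one_denom_ne_zero _), h1, h2]
  simp

end BerkovichLine

/-! ### Injective rational functions on ultrametric disks. -/

section Disk

variable {K : Type*} [NormedField K] [IsUltrametricDist K] {U : Set K}

theorem IsDisk.isOpen (hU : IsDisk U) : IsOpen U := by
  obtain ⟨x, ρ, hρ, rfl | rfl⟩ := hU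
  · exact Metric.isOpen_ball
  · exact IsUltrametricDist.isOpen_closedBall x hρ.ne'

theorem IsDisk.mem_of_norm_sub_le (hU : IsDisk U) {x y z : K} (hx : x ∈ U) (hy : y ∈ U)
    (h : ‖z - x‖ ≤ ‖y - x‖) : z ∈ U := by
  obtain ⟨u, ρ, hρ, rfl | rfl⟩ := hU
  · rw [mem_ball_iff_norm] at *
    have h1 := norm_sub_le_max' (y - u) (x - u)
    rw [sub_sub_sub_cancel_right] at h1
    have h2 := IsUltrametricDist.norm_add_le_max (z - x) (x - u)
    rw [sub_add_sub_cancel] at h2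
    exact h2.trans_lt (max_lt (h.trans_lt (h1.trans_lt (max_lt hy hx))) hx)
  · rw [mem_closedBall_iff_norm] at *
    have h1 := norm_sub_le_max' (y - u) (x - u)
    rw [sub_sub_sub_cancel_right] at h1
    have h2 := IsUltrametricDist.norm_add_le_max (z - x) (x - u)
    rw [sub_add_sub_cancel] at h2
    exact h2.trans (max_le (h.trans (h1.trans (max_le hy hx))) hx)

/-- Two points of a disk are closer to each other than to any point outside it. -/
theorem IsDisk.norm_sub_eq_of_notMem (hU : IsDisk U) {x z β : K} (hx : x ∈ U) (hz : z ∈ U)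
    (hβ : β ∉ U) : ‖z - β‖ = ‖x - β‖ := by
  have h : ‖z - x‖ < ‖x - β‖ := by
    by_contra! h
    exact hβ (hU.mem_of_norm_sub_le hx hz (by rwa [norm_sub_rev β x]))
  rw [← norm_add_eq_left_of_lt h, add_comm, sub_add_sub_cancel]

/-- A polynomial without roots in a disk has constant absolute value there. -/
theorem IsDisk.norm_eval_eq [IsAlgClosed K] (hU : IsDisk U) {g : K[X]}
    (hg : ∀ z ∈ U, g.eval z ≠ 0) {x z : K} (hx : x ∈ U) (hz : z ∈ U) :
    ‖g.eval z‖ = ‖g.eval x‖ := by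
  induction g using Polynomial.linear_factor_induction with
  | hC c => simp
  | hmul b g ih =>
    simp only [Polynomial.eval_mul, Polynomial.eval_sub, Polynomial.eval_X,
      Polynomial.eval_C] at hg ⊢
    have hb : b ∉ U := fun h => hg b h (by simp)
    rw [norm_mul, norm_mul, ih fun z hz => right_ne_zero_of_mul (hg z hz),
      hU.norm_sub_eq_of_notMem hx hz hb]

/-- If `P / Q` takes its value at `x` only once in a disk and has non-zero derivative at `x`,
then it scales distances from `x` by a constant factor. -/
theorem IsDisk.norm_cross_eq [IsAlgClosed K] (hU : IsDisk U) (P Q : K[X]) {x : K} (hx : x ∈ U)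
    (hinj : ∀ z ∈ U, P.eval z * Q.eval x = P.eval x * Q.eval z → z = x)
    (hW : (Polynomial.derivative P * Q - P * Polynomial.derivative Q).eval x ≠ 0)
    {z : K} (hz : z ∈ U) :
    ‖P.eval z * Q.eval x - P.eval x * Q.eval z‖ =
      ‖(Polynomial.derivative P * Q - P * Polynomial.derivative Q).eval x‖ * ‖z - x‖ := by
  set g : K[X] := P * Polynomial.C (Q.eval x) - Polynomial.C (P.eval x) * Q with hg
  have hgz : ∀ z, g.eval z = P.eval z * Q.eval x - P.eval x * Q.eval z := fun z => by simp [hg]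
  obtain ⟨R, hR⟩ : Polynomial.X - Polynomial.C x ∣ g := by
    rw [Polynomial.dvd_iff_isRoot, Polynomial.IsRoot, hgz, sub_self]
  have hgR : ∀ z, g.eval z = (z - x) * R.eval z := fun z => by simp [hR]
  -- Differentiate `g = (X - x) * R` at `x`. By injectivity `R` can vanish on the disk only at `x`,
  -- and there it is the non-zero Wronskian, so `|R|` is constant.
  have hRx : R.eval x = (Polynomial.derivative P * Q - P * Polynomial.derivative Q).eval x := by
    have h := congrArg (fun g => Polynomial.eval x (Polynomial.derivative g)) hR
    simpa [hg, eq_comm] using h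
  have hRne : ∀ z ∈ U, R.eval z ≠ 0 := fun z hz h => by
    have h0 : g.eval z = 0 := by rw [hgR, h, mul_zero]
    rw [hgz, sub_eq_zero] at h0
    rw [hinj z hz h0] at h
    exact hW (hRx ▸ h)
  rw [← hgz, hgR, norm_mul, hU.norm_eval_eq hRne hx hz, hRx, mul_comm]

end Disk

theorem exists_eval_ne_zero_of_isOpen {K : Type*} [NontriviallyNormedField K] {U : Set K}
    (hU : IsOpen U) (hne : U.Nonempty) {g : K[X]} (hg : g ≠ 0) : ∃ x ∈ U, g.eval x ≠ 0 := by
  obtain ⟨y, hy⟩ := hne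
  by_contra! h
  exact hg (Polynomial.eq_zero_of_infinite_isRoot g
    ((infinite_of_mem_nhds y (hU.mem_nhds hy)).mono h))

/-! ### Pointwise values, poles and factors. -/

section RatFunc

variable {K : Type*} [NormedField K]

theorem ratFuncToP1_div {P Q : K[X]} (hQ : Q ≠ 0)
    {f : RatFunc K} (hf : f = algebraMap K[X] (RatFunc K) P / algebraMap K[X] (RatFunc K) Q)
    {x : K} (hx : Q.eval x ≠ 0) :
    ratFuncToP1 f x = ((P.eval x / Q.eval x : K) : OnePoint K) := by
  have h := congrArg (Polynomial.eval x) (RatFunc.num_mul_eq_mul_denom_of_eq_div hQ hf)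
  rw [Polynomial.eval_mul, Polynomial.eval_mul] at h
  have hd : f.denom.eval x ≠ 0 := by
    obtain ⟨g, hg⟩ := hf ▸ RatFunc.denom_div_dvd P Q
    rw [hg, Polynomial.eval_mul] at hx
    exact left_ne_zero_of_mul hx
  rw [ratFuncToP1, if_neg hd, OnePoint.coe_eq_coe, div_eq_div_iff hd hx, h]

theorem ratFuncToP1_div_of_eval_eq_zero {P Q : K[X]} (hQ : Q ≠ 0)
    {f : RatFunc K} (hf : f = algebraMap K[X] (RatFunc K) P / algebraMap K[X] (RatFunc K) Q)
    {x : K} (hx : Q.eval x = 0) (hP : P.eval x ≠ 0) :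
    ratFuncToP1 f x = OnePoint.infty := by
  have h := congrArg (Polynomial.eval x) (RatFunc.num_mul_eq_mul_denom_of_eq_div hQ hf)
  rw [Polynomial.eval_mul, Polynomial.eval_mul, hx, mul_zero, eq_comm, mul_eq_zero] at h
  rw [ratFuncToP1, if_pos (h.resolve_left hP)]

/-- In cross-multiplied form the injectivity also covers poles: since `P` and `Q` have no common
zero, `x` and `z` are either both poles or both regular points. -/
theorem eq_of_cross_eq {P Q : K[X]} (hQ : Q ≠ 0)
    (hPQ : ∀ x, Q.eval x = 0 → P.eval x ≠ 0)
    {f : RatFunc K} (hf : f = algebraMap K[X] (RatFunc K) P / algebraMap K[X] (RatFunc K) Q)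
    {U : Set K} (hinj : Set.InjOn (ratFuncToP1 f) U) {x z : K} (hx : x ∈ U) (hz : z ∈ U)
    (h : P.eval z * Q.eval x = P.eval x * Q.eval z) : z = x := by
  refine hinj hz hx ?_
  by_cases hQx : Q.eval x = 0
  · have hQz : Q.eval z = 0 := by
      rw [hQx, mul_zero, eq_comm, mul_eq_zero] at h
      exact h.resolve_left (hPQ x hQx)
    rw [ratFuncToP1_div_of_eval_eq_zero hQ hf hQx (hPQ x hQx),
      ratFuncToP1_div_of_eval_eq_zero hQ hf hQz (hPQ z hQz)]
  · have hQz : Q.eval z ≠ 0 := fun hQz => by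
      rw [hQz, mul_zero, mul_eq_zero] at h
      exact hPQ z hQz (h.resolve_right hQx)
    rw [ratFuncToP1_div hQ hf hQx, ratFuncToP1_div hQ hf hQz, OnePoint.coe_eq_coe,
      div_eq_div_iff hQz hQx, h]

end RatFunc

section Factors

variable {K : Type*} [NormedField K] {N : ℕ} {a : Fin (N + 1) → K} {q : ℕ} {c : K}

theorem warpDenom_eval_eq_zero_iff (hq : q ≠ 0) {x : K} :
    (warpDenom a q).eval x = 0 ↔ ∃ j, x = a j := by
  rw [warpDenom, Polynomial.eval_prod, Finset.prod_eq_zero_iff]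
  simp [hq, sub_eq_zero]

/-- The factors of `warpFunction a q c`, as functions on `K`. -/
noncomputable def warpFactor (a : Fin (N + 1) → K) (q : ℕ) (c : K) (k : Fin (N + 1)) (z : K) : K :=
  (if k = 0 then z else 1) + c / (z - a k) ^ q

/-- The derivatives of the factors of `warpFunction a q c`. -/
noncomputable def warpFactorDeriv (a : Fin (N + 1) → K) (q : ℕ) (c : K) (k : Fin (N + 1))
    (z : K) : K :=
  (if k = 0 then 1 else 0) - q * (c / (z - a k) ^ q) / (z - a k)

theorem IsIslandCenters.warp_eval_div (ha : IsIslandCenters a) (hq : q ≠ 0) {x : K}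
    (hx : (warpDenom a q).eval x ≠ 0) :
    (warpNum a q c).eval x / (warpDenom a q).eval x = ∏ k, warpFactor a q c k x := by
  have hne : ∀ k, x - a k ≠ 0 := fun k h =>
    hx ((warpDenom_eval_eq_zero_iff hq).2 ⟨k, sub_eq_zero.1 h⟩)
  have hx0 : x ≠ 0 := by simpa [ha.1] using hne 0
  rw [Fin.prod_univ_succ, ha.warpDenom_eq, warpNum]
  simp only [Polynomial.eval_mul, Polynomial.eval_prod, Polynomial.eval_add, Polynomial.eval_sub,
    Polynomial.eval_pow, Polynomial.eval_X, Polynomial.eval_C]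
  rw [mul_div_mul_comm, ← Finset.prod_div_distrib]
  congr 1
  · simp only [warpFactor, ha.1, if_pos, sub_zero]
    field_simp
    ring
  · refine Finset.prod_congr rfl fun i _ => ?_
    have := pow_ne_zero q (hne i.succ)
    rw [warpFactor, if_neg (Fin.succ_ne_zero i)]
    field_simp

theorem IsIslandCenters.warpNum_eval_ne_zero [IsUltrametricDist K] (ha : IsIslandCenters a)
    (hq : q ≠ 0) (hc0 : c ≠ 0) (hc : ‖c‖ < 1) {x : K} (hx : (warpDenom a q).eval x = 0) :
    (warpNum a q c).eval x ≠ 0 := by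
  obtain ⟨j, rfl⟩ := (warpDenom_eval_eq_zero_iff hq).1 hx
  have key : ∀ (k : Fin (N + 1)) (m : ℕ), m ≠ 0 → (a j - a k) ^ m + c ≠ 0 := fun k m hm h => by
    rcases eq_or_ne j k with rfl | hjk
    · rw [sub_self, zero_pow hm, zero_add] at h
      exact hc0 h
    · have h1 : ‖(a j - a k) ^ m‖ = 1 := by rw [norm_pow, ha.2.2 j k hjk, one_pow]
      have h2 := norm_add_eq_left_of_lt (hc.trans_eq h1.symm)
      rw [h, h1, norm_zero] at h2
      exact zero_ne_one h2
  rw [warpNum, Polynomial.eval_mul, Polynomial.eval_prod]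
  refine mul_ne_zero ?_ (Finset.prod_ne_zero_iff.2 fun i _ => ?_)
  · simpa [ha.1] using key 0 (q + 1) (Nat.succ_ne_zero q)
  · simpa using key i.succ q hq

end Factors

/-! ### Location of preimages and size of the derivative near the poles. -/

section Estimates

variable {K : Type*} [NormedField K] [IsUltrametricDist K]

theorem norm_prod_one_add_sub_one_le {ι : Type*} (t : Finset ι) (ε : ι → K) {δ : ℝ}
    (hδ0 : 0 ≤ δ) (hδ : δ ≤ 1) (hε : ∀ i ∈ t, ‖ε i‖ ≤ δ) : ‖∏ i ∈ t, (1 + ε i) - 1‖ ≤ δ := by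
  classical
  induction t using Finset.induction_on with
  | empty => simpa using hδ0
  | insert i t hi ih =>
    have ih' := ih fun j hj => hε j (Finset.mem_insert_of_mem hj)
    have hi' := hε i (Finset.mem_insert_self i t)
    have e : ∏ j ∈ insert i t, (1 + ε j) - 1 =
        (∏ j ∈ t, (1 + ε j) - 1) + ε i * ((∏ j ∈ t, (1 + ε j) - 1) + 1) := by
      rw [Finset.prod_insert hi]
      ring
    rw [e]
    refine (IsUltrametricDist.norm_add_le_max _ _).trans (max_le ih' ?_)
    rw [norm_mul]
    refine (mul_le_of_le_one_right (norm_nonneg _) ?_).trans hi'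
    exact (IsUltrametricDist.norm_add_le_max _ _).trans (max_le (ih'.trans hδ) norm_one.le)

variable {N : ℕ} {a : Fin (N + 1) → K} {q : ℕ} {s : ℝ}

theorem IsIslandCenters.exists_norm_sub_lt (ha : IsIslandCenters a) (hs : 0 < s) (hs1 : s ≤ 1)
    {b : K} (hb : ‖b‖ < s) {x : K} {i : Fin (N + 1)}
    (h : ‖∏ k, warpFactor a q (-b ^ (1 + q)) k x - a i‖ < s) : ∃ j, ‖x - a j‖ < s := by
  by_contra! hx
  have hb1 : ‖b‖ < 1 := hb.trans_le hs1
  set ε : Fin (N + 1) → K := fun k => -b ^ (1 + q) / (x - a k) ^ q with hεdef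
  -- This is the purpose of the exponent `1 + q` in `c`: of the factors of `b`, `q` are absorbed by
  -- `(x - a_k) ^ q`, as `|b| < s ≤ |x - a_k|`, and one remains.
  have hε : ∀ k, ‖ε k‖ ≤ ‖b‖ := fun k => by
    have hpos : 0 < ‖x - a k‖ := hs.trans_le (hx k)
    rw [norm_div, norm_neg, norm_pow, norm_pow, div_le_iff₀ (by positivity), pow_add, pow_one]
    gcongr
    exact hb.le.trans (hx k)
  set η : K := ∏ i : Fin N, (1 + ε i.succ) - 1 with hηdef
  have hη : ‖η‖ ≤ ‖b‖ :=
    norm_prod_one_add_sub_one_le _ _ (norm_nonneg _) hb1.le fun i _ => hε i.succ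
  set v := ∏ k, warpFactor a q (-b ^ (1 + q)) k x with hv
  have hvx : v - x = ε 0 * (1 + η) + x * η := by
    have : v = (x + ε 0) * (1 + η) := by
      rw [hv, Fin.prod_univ_succ, hηdef, add_sub_cancel]
      simp [warpFactor, Fin.succ_ne_zero, hεdef]
    rw [this]
    ring
  have h1η : ‖1 + η‖ ≤ 1 := (IsUltrametricDist.norm_add_le_max _ _).trans
    (max_le norm_one.le (hη.trans hb1.le))
  have hle : ‖v - x‖ ≤ max ‖b‖ (‖x‖ * ‖b‖) := by
    rw [hvx]
    refine (IsUltrametricDist.norm_add_le_max _ _).trans (max_le_max ?_ ?_)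
    · rw [norm_mul]
      exact (mul_le_of_le_one_right (norm_nonneg _) h1η).trans (hε 0)
    · rw [norm_mul]
      gcongr
  -- If `|x| ≤ 1`, then `|v - x| < s` puts `x` itself in `D(a_i, s)`; if `|x| > 1`, then `|v| = |x|
  -- > 1`, although `v` is close to `a_i`.
  rcases le_or_gt ‖x‖ 1 with hx1 | hx1
  · have hlt : ‖v - x‖ < s := (hle.trans (max_le le_rfl
      (mul_le_of_le_one_left (norm_nonneg _) hx1))).trans_lt hb
    have h2 := norm_sub_le_max' (v - a i) (v - x)
    rw [sub_sub_sub_cancel_left] at h2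
    exact absurd (hx i) (not_le.2 (h2.trans_lt (max_lt h hlt)))
  · have hlt : ‖v - x‖ < ‖x‖ := by
      refine hle.trans_lt (max_lt (hb1.trans hx1) ?_)
      exact mul_lt_of_lt_one_right (by linarith) hb1
    have h2 := norm_add_eq_left_of_lt hlt
    rw [add_sub_cancel] at h2
    have h3 := IsUltrametricDist.norm_add_le_max (v - a i) (a i)
    rw [sub_add_cancel, h2] at h3
    exact absurd hx1 (not_lt.2 (h3.trans (max_le (h.le.trans hs1) (ha.norm_le_one i))))

/-- The sum is `f'(x)` by the Leibniz rule. Factors away from `a_j` have norm `1`, so `|f(x)| ≤ 1`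
bounds the factor at `a_j` and with it the singular term `c / (x - a_j) ^ q`; its derivative then
costs only `|q| / |x - a_j|`. -/
theorem IsIslandCenters.norm_sum_warpFactorDeriv_le (ha : IsIslandCenters a) {c : K}
    (hc : ‖c‖ < 1) {x : K} {j : Fin (N + 1)} (hxj : x ≠ a j) (hxj1 : ‖x - a j‖ < 1)
    (hv : ‖∏ k, warpFactor a q c k x‖ ≤ 1) :
    ‖∑ k, (∏ l ∈ Finset.univ.erase k, warpFactor a q c l x) * warpFactorDeriv a q c k x‖ *
      ‖x - a j‖ ≤ max ‖x - a j‖ ‖(q : K)‖ := by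
  have hr : 0 < ‖x - a j‖ := norm_pos_iff.2 (sub_ne_zero.2 hxj)
  have hx1 : ‖x‖ ≤ 1 := by
    have h := IsUltrametricDist.norm_add_le_max (x - a j) (a j)
    rw [sub_add_cancel] at h
    exact h.trans (max_le hxj1.le (ha.norm_le_one j))
  have hk : ∀ k, k ≠ j → ‖x - a k‖ = 1 := fun k hk => by
    have e : x - a k = (a j - a k) + (x - a j) := by ring
    rw [e, norm_add_eq_left_of_lt (by rwa [ha.2.2 j k hk.symm]), ha.2.2 j k hk.symm]
  have hck : ∀ k, k ≠ j → ‖c / (x - a k) ^ q‖ < 1 := fun k hkj => by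
    rwa [norm_div, norm_pow, hk k hkj, one_pow, div_one]
  have hmain : ∀ k : Fin (N + 1), ‖(if k = 0 then x else 1 : K)‖ ≤ 1 := fun k => by
    split_ifs
    · exact hx1
    · exact norm_one.le
  have hFk : ∀ k, k ≠ j → ‖warpFactor a q c k x‖ = 1 := fun k hkj => by
    have hm : ‖(if k = 0 then x else 1 : K)‖ = 1 := by
      split_ifs with h0
      · simpa [h0, ha.1] using hk k hkj
      · exact norm_one
    rw [warpFactor, norm_add_eq_left_of_lt (by rw [hm]; exact hck k hkj), hm]
  have hFj : ‖warpFactor a q c j x‖ ≤ 1 := by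
    rwa [← Finset.mul_prod_erase _ _ (Finset.mem_univ j), norm_mul, norm_prod,
      Finset.prod_eq_one (fun k hk => hFk k (Finset.ne_of_mem_erase hk)), mul_one] at hv
  have hF : ∀ k, ‖warpFactor a q c k x‖ ≤ 1 := fun k => by
    rcases eq_or_ne k j with rfl | h
    · exact hFj
    · exact (hFk k h).le
  have hcj : ∀ k, ‖c / (x - a k) ^ q‖ ≤ 1 := fun k => by
    have h := norm_sub_le_max' (warpFactor a q c k x) (ite (k = 0) x 1)
    rw [warpFactor, add_sub_cancel_left] at h
    exact h.trans (max_le (hF k) (hmain k))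
  have hF' : ∀ k, ‖warpFactorDeriv a q c k x‖ * ‖x - a j‖ ≤ max ‖x - a j‖ ‖(q : K)‖ := fun k => by
    have hi : ‖(if k = 0 then 1 else 0 : K)‖ ≤ 1 := by split_ifs <;> simp
    have hr' : ‖x - a j‖ ≤ ‖x - a k‖ := by
      rcases eq_or_ne k j with rfl | h
      · exact le_rfl
      · rw [hk k h]
        exact hxj1.le
    have hrk : 0 < ‖x - a k‖ := hr.trans_le hr'
    rw [warpFactorDeriv]
    refine (mul_le_mul_of_nonneg_right (norm_sub_le_max' _ _) hr.le).trans ?_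
    rw [max_mul_of_nonneg _ _ hr.le]
    refine max_le_max (mul_le_of_le_one_left hr.le hi) ?_
    rw [norm_div, norm_mul, div_mul_eq_mul_div, div_le_iff₀ hrk]
    exact mul_le_mul (mul_le_of_le_one_right (norm_nonneg _) (hcj k)) hr' hr.le (norm_nonneg _)
  rw [← norm_mul, Finset.sum_mul]
  refine IsUltrametricDist.norm_sum_le_of_forall_le_of_nonneg (le_max_of_le_left hr.le)
    fun k _ => ?_
  rw [mul_assoc, norm_mul, norm_prod, norm_mul]
  refine (mul_le_of_le_one_left (by positivity) ?_).trans (hF' k)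
  exact Finset.prod_le_one (fun _ _ => norm_nonneg _) fun l _ => hF l

end Estimates

section Derivative

variable {K : Type*} [NontriviallyNormedField K] {N : ℕ} {a : Fin (N + 1) → K} {q : ℕ} {c : K}

theorem hasDerivAt_warpFactor (k : Fin (N + 1)) {x : K} (hx : x ≠ a k) :
    HasDerivAt (warpFactor a q c k) (warpFactorDeriv a q c k x) x := by
  have hne : x - a k ≠ 0 := sub_ne_zero.2 hx
  have h1 : HasDerivAt (fun z : K => if k = 0 then z else 1) (if k = 0 then 1 else 0) x := by
    split_ifs
    · exact hasDerivAt_id x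
    · exact hasDerivAt_const x 1
  have h2 := (hasDerivAt_const x c).fun_div (((hasDerivAt_id x).sub_const (a k)).fun_pow q)
    (pow_ne_zero q hne)
  refine (h1.fun_add h2).congr_deriv ?_
  simp only [id_eq]
  rw [warpFactorDeriv, sub_eq_add_neg]
  cases q with
  | zero => simp
  | succ m =>
    rw [Nat.add_sub_cancel]
    field_simp
    ring

/-- Two expressions for `f'(x)`, by the quotient rule and by the product rule, agree by uniqueness
of the derivative. -/
theorem IsIslandCenters.warp_wronskian_div (ha : IsIslandCenters a) (hq : q ≠ 0) {x : K}
    (hx : (warpDenom a q).eval x ≠ 0) :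
    (Polynomial.derivative (warpNum a q c) * warpDenom a q -
      warpNum a q c * Polynomial.derivative (warpDenom a q)).eval x /
      (warpDenom a q).eval x ^ 2 =
    ∑ k, (∏ l ∈ Finset.univ.erase k, warpFactor a q c l x) * warpFactorDeriv a q c k x := by
  have h1 := ((warpNum a q c).hasDerivAt x).fun_div ((warpDenom a q).hasDerivAt x) hx
  have h2 := HasDerivAt.fun_finsetProd (u := Finset.univ) (f := warpFactor a q c)
    (f' := fun k => warpFactorDeriv a q c k x) (x := x) fun k _ =>
    hasDerivAt_warpFactor k fun h => hx ((warpDenom_eval_eq_zero_iff hq).2 ⟨k, h⟩)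
  have he : (fun z => ∏ k, warpFactor a q c k z) =ᶠ[nhds x]
      fun z => (warpNum a q c).eval z / (warpDenom a q).eval z := by
    filter_upwards [(warpDenom a q).continuous.continuousAt.eventually_ne hx] with z hz
    exact (ha.warp_eval_div hq hz).symm
  have h := h1.unique (h2.congr_of_eventuallyEq he.symm)
  simpa only [Polynomial.eval_sub, Polynomial.eval_mul, smul_eq_mul] using h

end Derivative

theorem IsIslandCenters.warp_wronskian_ne_zero {K : Type*} [NormedField K]
    [IsUltrametricDist K] {N : ℕ} {a : Fin (N + 1) → K} (ha : IsIslandCenters a) (q : ℕ) {c : K}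
    (hc : ‖c‖ < 1) :
    Polynomial.derivative (warpNum a q c) * warpDenom a q -
      warpNum a q c * Polynomial.derivative (warpDenom a q) ≠ 0 := fun h => by
  have h1 := BerkovichLine.diskPoint_zero_one_wronskian ha q hc
  rw [h, BerkovichLine.map_zero] at h1
  exact zero_ne_one h1

/-! ### No disk is mapped one-to-one onto an island. -/

section Islands

variable {K : Type*} [NontriviallyNormedField K] [IsUltrametricDist K] [IsAlgClosed K] {N : ℕ}
  {a : Fin (N + 1) → K} {q : ℕ} {s : ℝ}

theorem IsIslandCenters.not_mapsOneToOneOnto_island_some (ha : IsIslandCenters a)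
    (hq : q ≠ 0) (hqs : ‖(q : K)‖ < s) (hs : 0 < s) (hs1 : s ≤ 1) {b : K} (hb0 : b ≠ 0)
    (hb : ‖b‖ < s) (i : Fin (N + 1)) {U : Set K} (hU : IsDisk U) :
    ¬ MapsOneToOneOnto (warpFunction a q (-b ^ (1 + q))) U (island a s (some i)) := by
  rintro ⟨hinj, himg⟩
  set c := -b ^ (1 + q) with hcdef
  have hc0 : c ≠ 0 := neg_ne_zero.2 (pow_ne_zero _ hb0)
  have hc1 : ‖c‖ < 1 := by
    rw [hcdef, norm_neg, norm_pow]
    exact pow_lt_one₀ (norm_nonneg _) (hb.trans_le hs1) (by omega)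
  have hQ := warpDenom_ne_zero a q
  have hf := ha.warpFunction_eq_div q c
  have hPQ : ∀ x, (warpDenom a q).eval x = 0 → (warpNum a q c).eval x ≠ 0 :=
    fun x hx => ha.warpNum_eval_ne_zero hq hc0 hc1 hx
  have hQU : ∀ x ∈ U, (warpDenom a q).eval x ≠ 0 := fun x hx h => by
    have h1 : ratFuncToP1 (warpFunction a q c) x ∈ island a s (some i) :=
      himg ▸ Set.mem_image_of_mem _ hx
    rw [ratFuncToP1_div_of_eval_eq_zero hQ hf h (hPQ x h)] at h1
    obtain ⟨y, -, hy⟩ := h1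
    exact OnePoint.coe_ne_infty y hy
  have hval : ∀ x ∈ U, ratFuncToP1 (warpFunction a q c) x =
      ((∏ k, warpFactor a q c k x : K) : OnePoint K) := fun x hx => by
    rw [ratFuncToP1_div hQ hf (hQU x hx), ha.warp_eval_div hq (hQU x hx)]
  have hmem : ∀ x ∈ U, ‖∏ k, warpFactor a q c k x - a i‖ < s := fun x hx => by
    have h1 : ratFuncToP1 (warpFunction a q c) x ∈ island a s (some i) :=
      himg ▸ Set.mem_image_of_mem _ hx
    rw [hval x hx] at h1
    obtain ⟨y, hy, hyx⟩ := h1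
    rw [OnePoint.coe_eq_coe] at hyx
    rw [← hyx]
    exact mem_ball_iff_norm.1 hy
  have hsurj : ∀ y, ‖y - a i‖ < s → ∃ z ∈ U, ∏ k, warpFactor a q c k z = y := fun y hy => by
    have h1 : (y : OnePoint K) ∈ island a s (some i) := ⟨y, mem_ball_iff_norm.2 hy, rfl⟩
    rw [← himg] at h1
    obtain ⟨z, hz, hzy⟩ := h1
    rw [hval z hz, OnePoint.coe_eq_coe] at hzy
    exact ⟨z, hz, hzy⟩
  have hne : U.Nonempty := by
    obtain ⟨z, hz, -⟩ := hsurj (a i) (by simpa using hs)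
    exact ⟨z, hz⟩
  -- The scaling law needs `f'(x) ≠ 0`; the Wronskian has only finitely many zeros, and `U` is
  -- infinite.
  obtain ⟨x, hx, hWx⟩ := exists_eval_ne_zero_of_isOpen hU.isOpen hne
    (ha.warp_wronskian_ne_zero q hc1)
  obtain ⟨j, hj⟩ := ha.exists_norm_sub_lt hs hs1 hb (hmem x hx)
  have hxj : x ≠ a j := fun h => hQU x hx ((warpDenom_eval_eq_zero_iff hq).2 ⟨j, h⟩)
  have hajU : a j ∉ U := fun h => hQU _ h ((warpDenom_eval_eq_zero_iff hq).2 ⟨j, rfl⟩)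
  have hv1 : ‖∏ k, warpFactor a q c k x‖ ≤ 1 := by
    have h := IsUltrametricDist.norm_add_le_max (∏ k, warpFactor a q c k x - a i) (a i)
    rw [sub_add_cancel] at h
    exact h.trans (max_le ((hmem x hx).le.trans hs1) (ha.norm_le_one i))
  have hD := ha.norm_sum_warpFactorDeriv_le (q := q) hc1 hxj (hj.trans_le hs1) hv1
  rw [← ha.warp_wronskian_div hq (hQU x hx)] at hD
  have hM : max ‖x - a j‖ ‖(q : K)‖ < s := max_lt hj hqs
  -- `f(x) + e` still lies in the island, yet `e` is longer than the bound on `|f'(x)| |x - a_j|`.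
  obtain ⟨e, he, hes⟩ := exists_norm_between (K := K)
    (lt_max_of_lt_left (norm_pos_iff.2 (sub_ne_zero.2 hxj))) hM
  obtain ⟨z, hz, hze⟩ := hsurj (∏ k, warpFactor a q c k x + e) (by
    have e1 : ∏ k, warpFactor a q c k x + e - a i = (∏ k, warpFactor a q c k x - a i) + e := by
      ring
    rw [e1]
    exact (IsUltrametricDist.norm_add_le_max _ _).trans_lt (max_lt (hmem x hx) hes))
  have hcross := hU.norm_cross_eq (warpNum a q c) (warpDenom a q) hx
    (fun z hz h => eq_of_cross_eq hQ hPQ hf hinj hx hz h) hWx hz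
  have hzx : ‖z - x‖ ≤ ‖x - a j‖ := by
    by_contra! h
    exact hajU (hU.mem_of_norm_sub_le hx hz (by rw [norm_sub_rev]; exact h.le))
  have hQz := hU.norm_eval_eq hQU hx hz
  have hdiff : e = ((warpNum a q c).eval z * (warpDenom a q).eval x -
      (warpNum a q c).eval x * (warpDenom a q).eval z) /
      ((warpDenom a q).eval z * (warpDenom a q).eval x) := by
    have h1 := hQU x hx
    have h2 := hQU z hz
    rw [← ha.warp_eval_div hq h1, ← ha.warp_eval_div hq h2] at hze
    rw [← sub_eq_iff_eq_add', div_sub_div _ _ h2 h1] at hze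
    rw [← hze]
    ring
  -- This turns `|e|` into `|f'(x)| |z - x|`, and `|z - x| ≤ |x - a_j|` contradicts `hD`.
  rw [hdiff, norm_div, hcross, norm_mul, hQz, ← sq, mul_div_right_comm] at he
  rw [norm_div, norm_pow] at hD
  exact absurd (he.trans_le (mul_le_mul_of_nonneg_left hzx (by positivity))) (not_lt.2 hD)

theorem IsIslandCenters.not_mapsOneToOneOnto_island_none (ha : IsIslandCenters a)
    (hq : 2 ≤ q) (hs : 0 < s) {c : K} (hc0 : c ≠ 0) (hc1 : ‖c‖ < 1) {U : Set K}
    (hU : IsDisk U) :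
    ¬ MapsOneToOneOnto (warpFunction a q c) U (island a s none) := by
  rintro ⟨hinj, himg⟩
  have hq0 : q ≠ 0 := by omega
  have hQ := warpDenom_ne_zero a q
  have hf := ha.warpFunction_eq_div q c
  have hPQ : ∀ x, (warpDenom a q).eval x = 0 → (warpNum a q c).eval x ≠ 0 :=
    fun x hx => ha.warpNum_eval_ne_zero hq0 hc0 hc1 hx
  have hpole : ∀ j, (warpDenom a q).eval (a j) = 0 := fun j =>
    (warpDenom_eval_eq_zero_iff hq0).2 ⟨j, rfl⟩
  obtain ⟨j, hjU⟩ : ∃ j, a j ∈ U := by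
    have h : (OnePoint.infty : OnePoint K) ∈ island a s none := by simp [island]
    rw [← himg] at h
    obtain ⟨x, hx, hxi⟩ := h
    by_cases hQx : (warpDenom a q).eval x = 0
    · obtain ⟨j, rfl⟩ := (warpDenom_eval_eq_zero_iff hq0).1 hQx
      exact ⟨j, hx⟩
    · rw [ratFuncToP1_div hQ hf hQx] at hxi
      exact absurd hxi (OnePoint.coe_ne_infty _)
  have hPU : ∀ x ∈ U, (warpNum a q c).eval x ≠ 0 := fun x hx h => by
    have hQx : (warpDenom a q).eval x ≠ 0 := fun hQx => hPQ x hQx h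
    have h1 : ratFuncToP1 (warpFunction a q c) x ∈ island a s none :=
      himg ▸ Set.mem_image_of_mem _ hx
    rw [ratFuncToP1_div hQ hf hQx, h, zero_div] at h1
    exact h1 ⟨0, Metric.mem_closedBall_self (by positivity), rfl⟩
  set R : K[X] := ∏ k ∈ Finset.univ.erase j, (Polynomial.X - Polynomial.C (a k)) ^ q with hR
  have hQR : ∀ x, (warpDenom a q).eval x = (x - a j) ^ q * R.eval x := fun x => by
    rw [warpDenom, ← Finset.mul_prod_erase _ _ (Finset.mem_univ j)]
    simp [hR]
  have hRU : ∀ x ∈ U, R.eval x ≠ 0 := fun x hx h => by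
    rw [hR, Polynomial.eval_prod, Finset.prod_eq_zero_iff] at h
    obtain ⟨k, hk, hxk⟩ := h
    have hxk' : x = a k := by simpa [hq0, sub_eq_zero] using hxk
    subst hxk'
    have hkj : a k = a j := hinj hx hjU (by
      rw [ratFuncToP1_div_of_eval_eq_zero hQ hf (hpole k) (hPQ _ (hpole k)),
        ratFuncToP1_div_of_eval_eq_zero hQ hf (hpole j) (hPQ _ (hpole j))])
    have h1 := ha.2.2 k j (Finset.ne_of_mem_erase hk)
    rw [hkj, sub_self, norm_zero] at h1
    exact zero_ne_one h1
  obtain ⟨y, hyU, hy⟩ := exists_eval_ne_zero_of_isOpen hU.isOpen ⟨_, hjU⟩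
    (Polynomial.X_sub_C_ne_zero (a j))
  have hε : 0 < ‖y - a j‖ := norm_pos_iff.2 (by simpa using hy)
  -- The base point satisfies `0 < |x - a_j| < |y - a_j|`; the scaling law is then tested at `a_j`
  -- and at `y`.
  obtain ⟨x, hxb, hx⟩ := exists_eval_ne_zero_of_isOpen
    (Metric.isOpen_ball (x := a j) (ε := ‖y - a j‖)) ⟨_, Metric.mem_ball_self hε⟩
    (mul_ne_zero (ha.warp_wronskian_ne_zero q hc1) (Polynomial.X_sub_C_ne_zero (a j)))
  rw [mem_ball_iff_norm] at hxb
  rw [Polynomial.eval_mul] at hx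
  have hWx := left_ne_zero_of_mul hx
  have hδ : 0 < ‖x - a j‖ := norm_pos_iff.2 (by simpa using right_ne_zero_of_mul hx)
  have hxU : x ∈ U := hU.mem_of_norm_sub_le hjU hyU hxb.le
  have hcross : ∀ {z}, z ∈ U → _ := fun {z} hz =>
    hU.norm_cross_eq (warpNum a q c) (warpDenom a q) hxU
      (fun z hz h => eq_of_cross_eq hQ hPQ hf hinj hxU hz h) hWx (z := z) hz
  have hP := fun z hz => hU.norm_eval_eq hPU hxU (z := z) hz
  have hRe := fun z hz => hU.norm_eval_eq hRU hxU (z := z) hz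
  have hB := norm_pos_iff.2 (hPU x hxU)
  have hA := norm_pos_iff.2 (hRU x hxU)
  have hw := norm_pos_iff.2 hWx
  have h1 := hcross hjU
  have h2 := hcross hyU
  have hyx : ‖y - x‖ = ‖y - a j‖ := by
    have e : y - x = (y - a j) + -(x - a j) := by ring
    rw [e, norm_add_eq_left_of_lt (by rwa [norm_neg])]
  have hpow : ‖x - a j‖ ^ q < ‖y - a j‖ ^ q := pow_lt_pow_left₀ hxb hδ.le hq0
  -- `|P|` and the cofactor `|R|` are constant on `U`, so the two products differ in norm only
  -- through `|x - a_j| ^ q < |y - a_j| ^ q`.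
  have hlt : ‖(warpNum a q c).eval y * (warpDenom a q).eval x‖ <
      ‖(warpNum a q c).eval x * (warpDenom a q).eval y‖ := by
    rw [norm_mul, norm_mul, hQR, hQR, norm_mul, norm_mul, norm_pow, norm_pow, hP y hyU, hRe y hyU]
    gcongr
  rw [hpole, mul_zero, sub_zero, norm_mul, hP _ hjU, hQR, norm_mul, norm_pow,
    norm_sub_rev (a j) x] at h1
  rw [sub_eq_add_neg, add_comm, norm_add_eq_left_of_lt (by rwa [norm_neg]), norm_neg, norm_mul,
    hQR, norm_mul, norm_pow, hRe y hyU, hyx] at h2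
  obtain ⟨m, rfl⟩ : ∃ m, q = m + 2 := ⟨q - 2, by omega⟩
  set B := ‖(warpNum a (m + 2) c).eval x‖
  set A := ‖R.eval x‖
  set δ := ‖x - a j‖
  set ε := ‖y - a j‖
  -- Both sides equal the norm of the Wronskian at `x`: cancel `δ` in the test at `a_j` and `ε` in
  -- the test at `y`. As `q - 1 = m + 1 > 0`, this forces `δ = ε`.
  have h3 : B * (δ ^ (m + 1) * A) =
      B * (ε ^ (m + 1) * A) := by
    have h1' := mul_right_cancel₀ hδ.ne' (Eq.trans (by ring :
      B * (δ ^ (m + 1) * A) * δ = B * (δ ^ (m + 2) * A)) h1)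
    have h2' := mul_right_cancel₀ hε.ne' (Eq.trans (by ring :
      B * (ε ^ (m + 1) * A) * ε = B * (ε ^ (m + 2) * A)) h2)
    rw [h1', h2']
  have h4 := mul_right_cancel₀ hA.ne' (mul_left_cancel₀ hB.ne' h3)
  exact (pow_lt_pow_left₀ hxb hδ.le (Nat.succ_ne_zero m)).ne h4

end Islands

/-! ### Assembly of the theorem. -/

theorem mainTheorem3 {K : Type*} [NontriviallyNormedField K] [IsUltrametricDist K]
    [CompleteSpace K] [IsAlgClosed K] [CharZero K] (p : ℕ) (hp : 0 < p)
    [CharP (IsLocalRing.ResidueField (NormedField.valuation (K := K)).valuationSubring) p]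
    (N : ℕ) (s : ℝ) (hs : 0 < s) (hs1 : s ≤ 1)
    (ν₁ : BerkovichLine K) (hν₁ : ν₁ = BerkovichLine.diskPoint 0 1 one_pos) :
    (∃ a : Fin (N + 1) → K, IsIslandCenters a) ∧
    (∃ n : ℕ, 1 ≤ n ∧ ‖(p : K) ^ n‖ < s) ∧
    (∃ b : K, 0 < ‖b‖ ∧ ‖b‖ < s) ∧
    ∀ a : Fin (N + 1) → K, IsIslandCenters a →
      (∀ i j, i ≠ j → ∀ x ∈ island a s i, ∀ y ∈ island a s j,
        BerkovichLine.Separates (ν₁ : OnePoint (BerkovichLine K)) x y) ∧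
      (∀ (n : ℕ) (b c : K), 1 ≤ n → ‖(p : K) ^ n‖ < s → 0 < ‖b‖ → ‖b‖ < s →
        c = -b ^ (1 + p ^ n) →
        BerkovichLine.map (warpFunction a (p ^ n) c) ν₁ = (ν₁ : OnePoint (BerkovichLine K)) ∧
        BerkovichLine.boundaryLength (warpFunction a (p ^ n) c) ν₁ = 1 ∧
        ∀ i, ¬ ∃ U : Set K, IsDisk U ∧
          MapsOneToOneOnto (warpFunction a (p ^ n) c) U (island a s i)) ∧
      ∀ C : ℝ, C ≤ 1 → ¬ ∀ f : RatFunc K,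
        (∃ ν : BerkovichLine K, BerkovichLine.map f ν = (ν₁ : OnePoint (BerkovichLine K)) ∧
          C ≤ BerkovichLine.boundaryLength f ν) →
        ∃ i, ∃ U : Set K, IsDisk U ∧ MapsOneToOneOnto f U (island a s i) := by
  subst hν₁
  have hp1 : ‖(p : K)‖ < 1 := norm_natCast_lt_one_of_charP_residueField p
  have hp2 : 2 ≤ p := by
    rcases CharP.char_is_prime_or_zero
      (IsLocalRing.ResidueField (NormedField.valuation (K := K)).valuationSubring) p with h | h
    · exact h.two_le
    · exact absurd h hp.ne'
  have hcenters := exists_isIslandCenters K N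
  have hn : ∃ n : ℕ, 1 ≤ n ∧ ‖(p : K) ^ n‖ < s := by
    obtain ⟨n, hn⟩ := exists_pow_lt_of_lt_one hs hp1
    refine ⟨n + 1, by omega, ?_⟩
    rw [norm_pow]
    exact (pow_le_pow_of_le_one (norm_nonneg _) hp1.le n.le_succ).trans_lt hn
  have hb : ∃ b : K, 0 < ‖b‖ ∧ ‖b‖ < s := NormedField.exists_norm_lt K hs
  refine ⟨hcenters, hn, hb, fun a ha => ?_⟩
  have hmain : ∀ (n : ℕ) (b c : K), 1 ≤ n → ‖(p : K) ^ n‖ < s → 0 < ‖b‖ → ‖b‖ < s →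
      c = -b ^ (1 + p ^ n) →
      BerkovichLine.map (warpFunction a (p ^ n) c) (BerkovichLine.diskPoint 0 1 one_pos) =
        (BerkovichLine.diskPoint (0 : K) 1 one_pos : OnePoint (BerkovichLine K)) ∧
      BerkovichLine.boundaryLength (warpFunction a (p ^ n) c)
        (BerkovichLine.diskPoint 0 1 one_pos) = 1 ∧
      ∀ i, ¬ ∃ U : Set K, IsDisk U ∧
        MapsOneToOneOnto (warpFunction a (p ^ n) c) U (island a s i) := by
    rintro n b c hn hns hb0 hbs rfl
    have hb0' : b ≠ 0 := norm_pos_iff.1 hb0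
    have hc0 : -b ^ (1 + p ^ n) ≠ 0 := neg_ne_zero.2 (pow_ne_zero _ hb0')
    have hc1 : ‖-b ^ (1 + p ^ n)‖ < 1 := by
      rw [norm_neg, norm_pow]
      exact pow_lt_one₀ (norm_nonneg _) (hbs.trans_le hs1) (by omega)
    have hq : 2 ≤ p ^ n := hp2.trans (Nat.le_self_pow (by omega) p)
    refine ⟨BerkovichLine.map_warpFunction ha _ hc1,
      BerkovichLine.boundaryLength_warpFunction ha _ hc1, ?_⟩
    rintro (_ | i) ⟨U, hU, hmaps⟩
    · exact ha.not_mapsOneToOneOnto_island_none hq hs hc0 hc1 hU hmaps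
    · exact ha.not_mapsOneToOneOnto_island_some (by omega) (by rwa [Nat.cast_pow]) hs hs1 hb0' hbs
        i hU hmaps
  refine ⟨fun i j hij x hx y hy => BerkovichLine.separates_of_mem_island ha hs hs1 hij hx hy,
    hmain, fun C hC hall => ?_⟩
  -- A single function with `L = 1` at `ν₁` refutes every `C ≤ 1` at once.
  obtain ⟨n, hn1, hns⟩ := hn
  obtain ⟨b, hb0, hbs⟩ := hb
  obtain ⟨h1, h2, h3⟩ := hmain n b _ hn1 hns hb0 hbs rfl
  obtain ⟨i, hi⟩ := hall _ ⟨_, h1, hC.trans h2.ge⟩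
  exact h3 i hi
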